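/- **Setting.** Let $n\in\mathbb{N}$. Let $\mathcal{L}_2^n$ be the space of square-integrable signals $u:[0,\infty)\to\mathbb{R}^n$ with norm $\|u\|_2^2=\int_0^\infty|u(t)|^2dt$, let $\Gamma_T$ denote truncation to $[0,T]$ (and $0$ elsewhere), and let $\mathcal{L}_{2e}^n$ be the space of signals with $\Gamma_Tu\in\mathcal{L}_2^n$ for all $T>0$. A map $P$ on $\mathcal{L}_{2e}^n$ (or on $\mathcal{L}_{2e}^n\times\mathcal{L}_{2e}^n$) is *causal* if $\Gamma_Tu_1=\Gamma_Tu_2$ implies $\Gamma_TPu_1=\Gamma_TPu_2$ for all $T>0$; it is *(finite-gain) stable* if there is $\alpha>0$ with $\|\Gamma_TPu\|_2\le\alpha\|\Gamma_Tu\|_2$ for all $T\ge0$ and all $u$. Let $\mathcal{RH}_\infty^{n\times n}$ be the set of real rational $n\times n$ matrices that are holomorphic and bounded on $\{\mathrm{Re}\,s>0\}$. A causal linear time-invariant (LTI) system $P:\mathcal{L}_{2e}^n\to\mathcal{L}_{2e}^n$ has transfer matrix $\hat P\in\mathcal{RH}_\infty^{n\times n}$ if for every $u\in\mathcal{L}_2^n$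 the Laplace transform of $Pu$ exists for $\mathrm{Re}\,s>0$ and equals $\hat P(s)\hat u(s)$ there. Such a system is *negative imaginary* (NI) if $j(\hat P(j\omega)-\hat P(j\omega)^*)\ge0$ for all $\omega\in(0,\infty)$, and *strictly negative imaginary* (SNI) if $j(\hat P(j\omega)-\hat P(j\omega)^*)>0$ for all $\omega\in(0,\infty)$. Put $\hat P(j\infty)=\lim_{\omega\to\infty}\hat P(j\omega)$. The positive feedback interconnection $P\,\#\,C$ is *well-posed* if the map $F_{P,C}:(u_1,y_2)\mapsto(d_1,d_2)=(u_1-Cy_2,\;y_2-Pu_1)$ has a causal inverse on $\mathcal{L}_{2e}^n\times\mathcal{L}_{2e}^n$; it is *stable* if it is well-posed and $F_{P,C}^{-1}$ is finite-gain stable. **Corollary.** Let $P$ be an LTI system with transfer matrix $\hat P\in\mathcal{RH}_\infty^{n\times n}$ that is SNI, and $C$ an LTI system with transfer matrix $\hat C\in\mathcal{RH}_\infty^{n\times n}$ that is NI. Suppose there exist $\Xi_0=\Xi_0^*\in\mathbb{C}^{2n\times2n}$ and $\Xi_\infty=\Xi_\infty^*\in\mathbb{C}^{2n\times2n}$ such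 that for all $\tau\in[0,1]$ $$\begin{bmatrix}\hat P(j0)\\I_n\end{bmatrix}^T\Xi_0\begin{bmatrix}\hat P(j0)\\I_n\end{bmatrix}<0,\qquad \begin{bmatrix}I_n\\\tau\hat C(j0)\end{bmatrix}^T\Xi_0\begin{bmatrix}I_n\\\tau\hat C(j0)\end{bmatrix}\ge0,$$ $$\begin{bmatrix}\hat P(j\infty)\\I_n\end{bmatrix}^T\Xi_\infty\begin{bmatrix}\hat P(j\infty)\\I_n\end{bmatrix}<0,\qquad \begin{bmatrix}I_n\\\tau\hat C(j\infty)\end{bmatrix}^T\Xi_\infty\begin{bmatrix}I_n\\\tau\hat C(j\infty)\end{bmatrix}\ge0 .$$ Then the feedback interconnection $P\,\#\,C$ is well-posed and stable. -/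

import Mathlib

open MeasureTheory Filter Topology Set
open scoped Matrix ENNReal ComplexOrder

noncomputable section

namespace FeedbackNI

/-! ### Signals -/

/-- Lebesgue measure on the time axis `[0, ∞)`. -/
def timeMeasure : Measure ℝ := volume.restrict (Ici 0)

/-- Measurable signals `[0, ∞) → ℝⁿ`, up to equality almost everywhere. -/
abbrev Signal (n : ℕ) : Type := ℝ →ₘ[timeMeasure] EuclideanSpace ℝ (Fin n)

/-- The truncation `Γ_T`: keep the signal on `[0, T]`, put `0` elsewhere. -/
def truncSignal {n : ℕ} (T : ℝ) (u : Signal n) : Signal n :=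
  AEEqFun.mk ((Icc 0 T).indicator u) (u.aestronglyMeasurable.indicator measurableSet_Icc)

theorem coeFn_truncSignal {n : ℕ} (T : ℝ) (u : Signal n) :
    truncSignal T u =ᵐ[timeMeasure] (Icc 0 T).indicator u :=
  AEEqFun.coeFn_mk _ _

/-- The `L₂` norm (possibly `∞`) of a signal, `(∫₀^∞ |u(t)|² dt)^(1/2)`,
with `|·|` the Euclidean norm. -/
def l2norm {n : ℕ} (u : Signal n) : ℝ≥0∞ := eLpNorm u 2 timeMeasure

/-- `u ∈ L₂ⁿ`. -/
def InL2 {n : ℕ} (u : Signal n) : Prop := MemLp u 2 timeMeasure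

/-- The extended space `L₂ₑⁿ`: signals all of whose truncations lie in `L₂ⁿ`. -/
def L2e (n : ℕ) : Submodule ℝ (Signal n) where
  carrier := {u | ∀ T : ℝ, 0 < T → InL2 (truncSignal T u)}
  zero_mem' := by
    intro T _
    have h : truncSignal T (0 : Signal n) =ᵐ[timeMeasure] 0 := by
      filter_upwards [coeFn_truncSignal T (0 : Signal n),
        (AEEqFun.coeFn_zero : ⇑(0 : Signal n) =ᵐ[timeMeasure] 0)] with t h1 h2
      rw [h1]
      by_cases ht : t ∈ Icc 0 T <;> simp [indicator, h2]
    exact (memLp_congr_ae h).2 MemLp.zero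
  add_mem' := by
    intro u v hu hv T hT
    have h : truncSignal T (u + v) =ᵐ[timeMeasure]
        ⇑(truncSignal T u) + ⇑(truncSignal T v) := by
      filter_upwards [coeFn_truncSignal T (u + v), coeFn_truncSignal T u,
        coeFn_truncSignal T v, AEEqFun.coeFn_add u v] with t h1 h2 h3 h4
      rw [h1, Pi.add_apply, h2, h3]
      by_cases ht : t ∈ Icc 0 T
      · simp only [indicator_of_mem ht, h4, Pi.add_apply]
      · simp only [indicator_of_notMem ht, add_zero]
    exact (memLp_congr_ae h).2 ((hu T hT).add (hv T hT))
  smul_mem' := by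
    intro c u hu T hT
    have h : truncSignal T (c • u) =ᵐ[timeMeasure] c • ⇑(truncSignal T u) := by
      filter_upwards [coeFn_truncSignal T (c • u), coeFn_truncSignal T u,
        AEEqFun.coeFn_smul c u] with t h1 h2 h3
      rw [h1, Pi.smul_apply, h2]
      by_cases ht : t ∈ Icc 0 T
      · simp only [indicator_of_mem ht, h3, Pi.smul_apply]
      · simp only [indicator_of_notMem ht, smul_zero]
    exact (memLp_congr_ae h).2 ((hu T hT).const_smul c)

theorem truncSignal_truncSignal {n : ℕ} (S T : ℝ) (u : Signal n) :
    truncSignal S (truncSignal T u) = truncSignal T (truncSignal S u) := by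
  apply AEEqFun.ext
  filter_upwards [coeFn_truncSignal S (truncSignal T u), coeFn_truncSignal T u,
    coeFn_truncSignal T (truncSignal S u), coeFn_truncSignal S u] with t h1 h2 h3 h4
  rw [h1, h3]
  by_cases hS : t ∈ Icc 0 S <;> by_cases hT : t ∈ Icc 0 T <;>
    simp only [indicator_of_mem, indicator_of_notMem, hS, hT, h2, h4, not_false_eq_true]

theorem InL2.truncSignal {n : ℕ} {u : Signal n} (hu : InL2 u) (T : ℝ) :
    InL2 (truncSignal T u) :=
  (memLp_congr_ae (coeFn_truncSignal T u)).2 (hu.indicator measurableSet_Icc)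

/-- The truncation `Γ_T` as a map of `L₂ₑⁿ`. -/
def trunc {n : ℕ} (T : ℝ) (u : L2e n) : L2e n :=
  ⟨truncSignal T u, fun S hS => by
    rw [truncSignal_truncSignal]
    exact (u.2 S hS).truncSignal T⟩

/-! ### Systems and feedback interconnections -/

/-- A (nonlinear) system with `n` inputs and `n` outputs. -/
abbrev System (n : ℕ) : Type := L2e n → L2e n

/-- Causality. -/
def Causal {n : ℕ} (P : System n) : Prop :=
  ∀ T : ℝ, 0 < T → ∀ u₁ u₂ : L2e n,
    trunc T u₁ = trunc T u₂ → trunc T (P u₁) = trunc T (P u₂)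

/-- Causality for maps of `L₂ₑⁿ × L₂ₑⁿ`. -/
def CausalPair {n : ℕ} (H : L2e n × L2e n → L2e n × L2e n) : Prop :=
  ∀ T : ℝ, 0 < T → ∀ d e : L2e n × L2e n,
    Prod.map (trunc T) (trunc T) d = Prod.map (trunc T) (trunc T) e →
      Prod.map (trunc T) (trunc T) (H d) = Prod.map (trunc T) (trunc T) (H e)

/-- The `L₂` norm of a stacked pair of signals. -/
def l2normPair {n : ℕ} (d : L2e n × L2e n) : ℝ≥0∞ :=
  (l2norm (d.1 : Signal n) ^ 2 + l2norm (d.2 : Signal n) ^ 2) ^ (1 / 2 : ℝ)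

/-- Finite-gain stability for maps of `L₂ₑⁿ × L₂ₑⁿ`. -/
def FiniteGainStablePair {n : ℕ} (H : L2e n × L2e n → L2e n × L2e n) : Prop :=
  ∃ α : ℝ, 0 < α ∧ ∀ T : ℝ, 0 ≤ T → ∀ d : L2e n × L2e n,
    l2normPair (Prod.map (trunc T) (trunc T) (H d)) ≤
      ENNReal.ofReal α * l2normPair (Prod.map (trunc T) (trunc T) d)

/-- The operator `(u₁, y₂) ↦ (d₁, d₂) = (u₁ - C y₂, y₂ - P u₁)` of the positive feedback
interconnection `P # C`. -/
def feedbackMap {n : ℕ} (P C : System n) (x : L2e n × L2e n) : L2e n × L2e n :=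
  (x.1 - C x.2, x.2 - P x.1)

/-- `H` is a causal two-sided inverse of the operator of `P # C`. -/
structure IsCausalInverse {n : ℕ} (P C : System n)
    (H : L2e n × L2e n → L2e n × L2e n) : Prop where
  left_inv : Function.LeftInverse H (feedbackMap P C)
  right_inv : Function.RightInverse H (feedbackMap P C)
  causal : CausalPair H

/-- Well-posedness of `P # C`: its operator is causally invertible. -/
def WellPosed {n : ℕ} (P C : System n) : Prop := ∃ H, IsCausalInverse P C H

/-- Stability of `P # C`: it is well-posed and the (unique) inverse of its operator is
finite-gain stable. -/
def ClosedLoopStable {n : ℕ} (P C : System n) : Prop :=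
  WellPosed P C ∧ ∀ H, IsCausalInverse P C H → FiniteGainStablePair H

/-! ### Transfer matrices -/

/-- An `n × n` matrix of real rational functions. -/
abbrev TransferMatrix (n : ℕ) : Type := Matrix (Fin n) (Fin n) (RatFunc ℝ)

/-- The value `Ĝ(s)` at a complex number `s` that is not a pole. -/
def TransferMatrix.at {n : ℕ} (G : TransferMatrix n) (s : ℂ) : Matrix (Fin n) (Fin n) ℂ :=
  Matrix.map G (RatFunc.eval (algebraMap ℝ ℂ) s)

/-- The value `Ĝ(j∞) = lim_{ω → ∞} Ĝ(jω)`. -/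
def TransferMatrix.atInfty {n : ℕ} (G : TransferMatrix n) : Matrix (Fin n) (Fin n) ℂ :=
  limUnder atTop (fun ω : ℝ => TransferMatrix.at G (Complex.I * ω))

/-- `Ĝ ∈ RH_∞`: real rational, holomorphic and bounded on the open right half-plane. -/
structure IsRHInfty {n : ℕ} (G : TransferMatrix n) : Prop where
  holomorphic : ∀ i k, DifferentiableOn ℂ (fun s => TransferMatrix.at G s i k) {s | 0 < s.re}
  bounded : ∃ M : ℝ, ∀ s : ℂ, 0 < s.re → ∀ i k, ‖TransferMatrix.at G s i k‖ ≤ M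

/-- Negative imaginary transfer matrices. -/
structure IsNI {n : ℕ} (G : TransferMatrix n) : Prop where
  stable : IsRHInfty G
  nonneg : ∀ ω : ℝ, 0 < ω →
    (Complex.I • (TransferMatrix.at G (Complex.I * ω) -
      (TransferMatrix.at G (Complex.I * ω))ᴴ)).PosSemidef

/-- Strictly negative imaginary transfer matrices. -/
structure IsSNI {n : ℕ} (G : TransferMatrix n) : Prop where
  stable : IsRHInfty G
  pos : ∀ ω : ℝ, 0 < ω →
    (Complex.I • (TransferMatrix.at G (Complex.I * ω) -
      (TransferMatrix.at G (Complex.I * ω))ᴴ)).PosDef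

/-- The block column `[A; B]`. -/
def stack {n : ℕ} (A B : Matrix (Fin n) (Fin n) ℂ) : Matrix (Fin n ⊕ Fin n) (Fin n) ℂ :=
  Matrix.fromRows A B

/-- The matrix `[A; B]ᵀ Ξ [A; B]`. -/
def quadForm {n : ℕ} (Ξ : Matrix (Fin n ⊕ Fin n) (Fin n ⊕ Fin n) ℂ)
    (A B : Matrix (Fin n) (Fin n) ℂ) : Matrix (Fin n) (Fin n) ℂ :=
  (stack A B)ᵀ * Ξ * stack A B

/-! ### Linear time-invariant systems -/

/-- The Laplace transform `û(s) = ∫₀^∞ e^{-st} u(t) dt`, componentwise. -/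
def laplace {n : ℕ} (u : Signal n) (s : ℂ) : Fin n → ℂ :=
  fun i => ∫ t, Complex.exp (-(s * t)) * ((u t i : ℝ) : ℂ) ∂timeMeasure

/-- The integrals that define `laplace u s` converge absolutely. -/
def LaplaceConverges {n : ℕ} (u : Signal n) (s : ℂ) : Prop :=
  ∀ i, Integrable (fun t : ℝ => Complex.exp (-(s * t)) * ((u t i : ℝ) : ℂ)) timeMeasure

/-- `v` is the signal `u` delayed by `T`. -/
def IsDelay {n : ℕ} (T : ℝ) (u v : Signal n) : Prop :=
  ∀ᵐ t ∂timeMeasure, v t = if T ≤ t then u (t - T) else 0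

/-- `P` is the causal linear time-invariant system with the (stable) transfer matrix `G`:
for every input `u ∈ L₂`, the output `y = P u` has a Laplace transform on the open right
half-plane, and it is given there by `ŷ(s) = Ĝ(s) û(s)`. -/
structure IsLTIWithTransferMatrix {n : ℕ} (P : System n) (G : TransferMatrix n) : Prop where
  causal : Causal P
  map_add : ∀ u v : L2e n, P (u + v) = P u + P v
  map_smul : ∀ (c : ℝ) (u : L2e n), P (c • u) = c • P u
  time_invariant : ∀ (T : ℝ) (u v : L2e n), 0 ≤ T →
    IsDelay T (u : Signal n) (v : Signal n) → IsDelay T (P u : Signal n) (P v : Signal n)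
  transfer : ∀ u : L2e n, InL2 (u : Signal n) → ∀ s : ℂ, 0 < s.re →
    LaplaceConverges (P u : Signal n) s ∧
      laplace (P u : Signal n) s = TransferMatrix.at G s *ᵥ laplace (u : Signal n) s

end FeedbackNI

end

/-! The heart of the matter is that `1 - τ C P` cannot degenerate on the imaginary axis or at
infinity, for any `τ ∈ [0, 1]`. Suppose `w = P v` and `v = τ C w` with `v ≠ 0`. At a positive
frequency SNI makes `Im v*Pv` negative, while NI makes `Im v*Pv = -τ Im w*Cw` nonnegative. Negative
frequencies follow by conjugation. At `0` and `∞` the vectors `[Pv; v]` and `[w; τCw]` coincide, yet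
the form of `Ξ` is negative on the first and nonnegative on the second.

Compactness turns this into a lower bound for `1 - τ C P`, uniform in `τ`, on a thin strip `0 < Re s
< ε` (`exists_uniform_lower_bound`). Plancherel on vertical lines of the strip, followed by `Re s →
0`, transfers the bound to `L₂` (`exists_return_difference_bound`), so boundary values of Laplace
transforms are never needed.

A lower bound alone gives neither surjectivity nor causality. Both come from continuation in `τ`,
starting at the identity, inside the Banach algebra of causal operators on `L₂`
(`isUnit_one_sub_of_inverse_bound`). The causal inverse of `1 - C P` then extends to `L₂ₑ` by
truncation, and the inverse of the whole loop is an explicit expression in it. -/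

noncomputable section

namespace FeedbackNI

/-! ### Plancherel's theorem for integrable functions with Hilbert-space values. -/

section Plancherel

open scoped FourierTransform SchwartzMap ContDiff

variable {F : Type*} [NormedAddCommGroup F] [InnerProductSpace ℂ F]

theorem continuous_fourier {f : ℝ → F} (hf : Integrable f) : Continuous (𝓕 f) :=
  VectorFourier.fourierIntegral_continuous Real.continuous_fourierChar
    (by exact continuous_inner) hf

variable [CompleteSpace F]

theorem ae_eq_of_integral_schwartz_smul_eq {f g : ℝ → F} (hf : LocallyIntegrable f)
    (hg : LocallyIntegrable g)
    (h : ∀ φ : 𝓢(ℝ, ℂ), ∫ x, φ x • f x = ∫ x, φ x • g x) : f =ᵐ[volume] g := by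
  refine ae_eq_of_integral_contDiff_smul_eq hf hg fun φ hφ hc => ?_
  have h₁ : HasCompactSupport (Complex.ofRealCLM ∘ φ) := hc.comp_left rfl
  have h₂ : ContDiff ℝ ∞ (Complex.ofRealCLM ∘ φ) := by fun_prop
  simpa using h (h₁.toSchwartzMap h₂)

/-- This pairing identifies the Fourier integral of an integrable function with the distributional
transform, and hence with the `L₂` one. -/
theorem integral_fourier_schwartz_smul (φ : 𝓢(ℝ, ℂ)) {f : ℝ → F} (hf : Integrable f) :
    ∫ x, (𝓕 φ) x • f x = ∫ x, φ x • 𝓕 f x := by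
  have := VectorFourier.integral_fourierIntegral_smul_eq_flip (μ := volume) (ν := volume)
    (L := innerₗ ℝ) (e := Real.fourierChar) (f := (φ : ℝ → ℂ)) (g := f)
    Real.continuous_fourierChar continuous_inner φ.integrable hf
  simpa [SchwartzMap.fourier_coe, Real.fourier_eq, VectorFourier.fourierIntegral] using! this

/-- Plancherel's theorem for integrable functions: one side is finite iff the other is. -/
theorem eLpNorm_fourier_eq {f : ℝ → F} (hf : Integrable f) :
    eLpNorm (𝓕 f) 2 volume = eLpNorm f 2 volume := by
  by_cases h2 : MemLp f 2 volume
  · have key : (𝓕 (h2.toLp f) : Lp F 2 volume) =ᵐ[volume] 𝓕 f := by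
      refine ae_eq_of_integral_schwartz_smul_eq
        ((Lp.memLp _).locallyIntegrable (by norm_num)) (continuous_fourier hf).locallyIntegrable
        fun φ => ?_
      rw [← integral_fourier_schwartz_smul φ hf, ← Lp.toTemperedDistribution_apply,
        ← Lp.fourier_toTemperedDistribution_eq, TemperedDistribution.fourier_apply,
        Lp.toTemperedDistribution_apply]
      refine integral_congr_ae ?_
      filter_upwards [h2.coeFn_toLp] with x hx
      rw [hx]
    rw [← eLpNorm_congr_ae key, ← eLpNorm_congr_ae h2.coeFn_toLp, ← Lp.enorm_def, ← Lp.enorm_def,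
      ← ofReal_norm, ← ofReal_norm, Lp.norm_fourier_eq]
  -- If `f ∉ L₂`, then `𝓕 f ∉ L₂` too: otherwise its inverse `L₂` transform would agree with `f`
  -- almost everywhere.
  by_cases h3 : MemLp (𝓕 f) 2 volume
  · have key : (𝓕⁻ (h3.toLp (𝓕 f)) : Lp F 2 volume) =ᵐ[volume] f := by
      refine ae_eq_of_integral_schwartz_smul_eq
        ((Lp.memLp _).locallyIntegrable (by norm_num)) hf.locallyIntegrable fun φ => ?_
      rw [← Lp.toTemperedDistribution_apply,
        ← Lp.fourierInv_toTemperedDistribution_eq, TemperedDistribution.fourierInv_apply,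
        Lp.toTemperedDistribution_apply]
      have h4 := integral_fourier_schwartz_smul (𝓕⁻ φ) hf
      rw [FourierTransform.fourier_fourierInv_eq] at h4
      rw [h4]
      refine integral_congr_ae ?_
      filter_upwards [h3.coeFn_toLp] with x hx
      rw [hx]
    exact absurd ((memLp_congr_ae key).1 (Lp.memLp _)) h2
  · have h5 : eLpNorm f 2 volume = ⊤ := by
      by_contra h
      exact h2 ⟨hf.aestronglyMeasurable, lt_top_iff_ne_top.2 h⟩
    have h6 : eLpNorm (𝓕 f) 2 volume = ⊤ := by
      by_contra h
      exact h3 ⟨(continuous_fourier hf).aestronglyMeasurable, lt_top_iff_ne_top.2 h⟩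
    rw [h5, h6]

end Plancherel

/-! ### Rational functions bounded on the open right half-plane. -/

section Rational

open Polynomial ComplexConjugate

variable {g : RatFunc ℝ} {M : ℝ}

theorem ratFunc_eval_conj (g : RatFunc ℝ) (s : ℂ) :
    g.eval (algebraMap ℝ ℂ) (conj s) = conj (g.eval (algebraMap ℝ ℂ) s) := by
  have key (p : ℝ[X]) : p.eval₂ (algebraMap ℝ ℂ) (conj s) = conj (p.eval₂ (algebraMap ℝ ℂ) s) := by
    rw [Polynomial.hom_eval₂]
    congr 1
    ext x
    simp
  simp only [RatFunc.eval, key, map_div₀]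

/-- Boundedness in the open half-plane also excludes poles on the imaginary axis: approaching a root
`s` of the denominator along `s + ε`, the inequality `|num| ≤ M |denom|` would force a common root,
against coprimality. -/
theorem denom_eval_ne_zero (hM : ∀ s : ℂ, 0 < s.re → ‖g.eval (algebraMap ℝ ℂ) s‖ ≤ M)
    {s : ℂ} (hs : 0 ≤ s.re) : g.denom.eval₂ (algebraMap ℝ ℂ) s ≠ 0 := by
  intro h0
  set p : ℂ → ℂ := fun z => g.num.eval₂ (algebraMap ℝ ℂ) z
  set q : ℂ → ℂ := fun z => g.denom.eval₂ (algebraMap ℝ ℂ) z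
  have hp : Continuous p := Polynomial.continuous_eval₂ _ _
  have hq : Continuous q := Polynomial.continuous_eval₂ _ _
  obtain ⟨a, b, hab⟩ := g.isCoprime_num_denom
  have hp0 : p s ≠ 0 := by
    intro hp0
    have := congrArg (Polynomial.eval₂ (algebraMap ℝ ℂ) s) hab
    simp only [Polynomial.eval₂_add, Polynomial.eval₂_mul, Polynomial.eval₂_one] at this
    rw [h0, show g.num.eval₂ (algebraMap ℝ ℂ) s = 0 from hp0] at this
    simp at this
  have hfin : {z : ℂ | q z = 0}.Finite := by
    have hne : g.denom.map (algebraMap ℝ ℂ) ≠ 0 :=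
      (Polynomial.map_ne_zero_iff (algebraMap ℝ ℂ).injective).2 g.denom_ne_zero
    refine (Polynomial.finite_setOfPred_isRoot hne).subset fun z hz => ?_
    simpa [Polynomial.IsRoot, Polynomial.eval_map] using hz
  have hline : Tendsto (fun ε : ℝ => s + (ε : ℂ)) (𝓝[>] 0) (𝓝 s) := by
    have : Continuous fun ε : ℝ => s + (ε : ℂ) := by fun_prop
    have := this.tendsto 0
    simp only [Complex.ofReal_zero, add_zero] at this
    exact this.mono_left nhdsWithin_le_nhds
  have hline' : Tendsto (fun ε : ℝ => s + (ε : ℂ)) (𝓝[>] 0) (𝓝[≠] s) := by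
    refine tendsto_nhdsWithin_iff.2 ⟨hline, ?_⟩
    filter_upwards [self_mem_nhdsWithin] with ε (hε : 0 < ε)
    simpa using hε.ne'
  -- Evaluation at a root of the denominator returns the junk value `0`, so the bound is informative
  -- only off the roots, which are isolated.
  have hev : ∀ᶠ z in 𝓝[≠] s, q z ≠ 0 := by
    have : ∀ᶠ z in 𝓝[≠] s, z ∉ {z : ℂ | q z = 0} \ {s} := by
      refine eventually_nhdsWithin_of_eventually_nhds ?_
      exact (hfin.subset sdiff_subset).isClosed.isOpen_compl.mem_nhds (by simp)
    filter_upwards [this, self_mem_nhdsWithin] with z hz hzs hq0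
    exact hz ⟨hq0, hzs⟩
  have hle : ∀ᶠ ε : ℝ in 𝓝[>] 0, ‖p (s + ε)‖ ≤ M * ‖q (s + ε)‖ := by
    filter_upwards [hline'.eventually hev, self_mem_nhdsWithin] with ε h1 (h2 : 0 < ε)
    have h3 := hM (s + ε) (by simp; linarith)
    rw [RatFunc.eval, norm_div, div_le_iff₀ (norm_pos_iff.2 h1)] at h3
    exact h3
  have hlim := le_of_tendsto_of_tendsto ((hp.norm.tendsto s).comp hline)
    (((hq.norm.tendsto s).comp hline).const_mul M) hle
  rw [show q s = 0 from h0] at hlim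
  simp only [norm_zero, mul_zero, norm_le_zero_iff] at hlim
  exact hp0 hlim

theorem continuousAt_ratFunc_eval (hM : ∀ s : ℂ, 0 < s.re → ‖g.eval (algebraMap ℝ ℂ) s‖ ≤ M)
    {s : ℂ} (hs : 0 ≤ s.re) : ContinuousAt (fun z => g.eval (algebraMap ℝ ℂ) z) s :=
  ((Polynomial.continuous_eval₂ _ _).continuousAt).div
    ((Polynomial.continuous_eval₂ _ _).continuousAt) (denom_eval_ne_zero hM hs)

theorem ratFunc_eval_ofReal (g : RatFunc ℝ) (x : ℝ) :
    g.eval (algebraMap ℝ ℂ) (x : ℂ) = ((g.num.eval x / g.denom.eval x : ℝ) : ℂ) := by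
  have key (p : ℝ[X]) : p.eval₂ (algebraMap ℝ ℂ) (x : ℂ) = ((p.eval x : ℝ) : ℂ) :=
    Polynomial.eval₂_at_apply (algebraMap ℝ ℂ) x
  simp only [RatFunc.eval, key, Complex.ofReal_div]

/-- Otherwise `|g|` would be unbounded along the positive real axis. -/
theorem natDegree_num_le (hM : ∀ s : ℂ, 0 < s.re → ‖g.eval (algebraMap ℝ ℂ) s‖ ≤ M) :
    g.num.natDegree ≤ g.denom.natDegree := by
  by_contra! h
  have h1 := Polynomial.abs_div_tendsto_atTop_atTop_of_degree_gt g.num g.denom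
    (Polynomial.degree_lt_degree h) g.denom_ne_zero
  obtain ⟨x, hx, hx0⟩ := ((h1.eventually_gt_atTop M).and (eventually_gt_atTop 0)).exists
  have h2 := hM x (by simpa using hx0)
  rw [ratFunc_eval_ofReal, Complex.norm_real, Real.norm_eq_abs] at h2
  linarith

/-- `N` may exceed the degree, the limit then being `0`; the numerator is thus scaled by the degree
of the denominator. -/
theorem tendsto_eval_div_pow (p : ℝ[X]) {N : ℕ} (hN : p.natDegree ≤ N) :
    Tendsto (fun s : ℂ => p.eval₂ (algebraMap ℝ ℂ) s / s ^ N) (cocompact ℂ)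
      (𝓝 (p.coeff N : ℂ)) := by
  have hterm : ∀ k ∈ Finset.range (N + 1),
      Tendsto (fun s : ℂ => (p.coeff k : ℂ) * s ^ k / s ^ N) (cocompact ℂ)
        (𝓝 (if k = N then (p.coeff N : ℂ) else 0)) := by
    intro k hk
    have hne : ∀ᶠ s : ℂ in cocompact ℂ, s ≠ 0 := by
      have := (isCompact_singleton (x := (0 : ℂ))).compl_mem_cocompact
      filter_upwards [this] with s hs using hs
    split_ifs with h
    · subst h
      refine tendsto_const_nhds.congr' ?_
      filter_upwards [hne] with s hs
      rw [mul_div_assoc, div_self (pow_ne_zero _ hs), mul_one]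
    · have hlt : k < N := lt_of_le_of_ne (by simpa [Nat.lt_succ_iff] using hk) h
      have h1 : Tendsto (fun s : ℂ => (p.coeff k : ℂ) * (s⁻¹) ^ (N - k)) (cocompact ℂ) (𝓝 0) := by
        have := ((tendsto_inv₀_cobounded (α := ℂ)).pow (N - k)).const_mul (p.coeff k : ℂ)
        rw [zero_pow (by omega), mul_zero, Metric.cobounded_eq_cocompact] at this
        exact this
      refine h1.congr' ?_
      filter_upwards [hne] with s hs
      have : s ^ N = s ^ (N - k) * s ^ k := by rw [← pow_add]; congr 1; omega
      rw [this, inv_pow]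
      field_simp
  have := tendsto_finsetSum _ hterm
  simp only [Finset.sum_ite_eq', Finset.mem_range, Nat.lt_succ_self, if_true] at this
  refine this.congr fun s => ?_
  rw [Polynomial.eval₂_eq_sum_range' _ (Nat.lt_succ_of_le hN), Finset.sum_div]
  rfl

theorem exists_tendsto_ratFunc_eval
    (hM : ∀ s : ℂ, 0 < s.re → ‖g.eval (algebraMap ℝ ℂ) s‖ ≤ M) :
    ∃ c : ℝ, Tendsto (fun s => g.eval (algebraMap ℝ ℂ) s) (cocompact ℂ) (𝓝 (c : ℂ)) := by
  refine ⟨g.num.coeff g.denom.natDegree / g.denom.coeff g.denom.natDegree, ?_⟩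
  have h1 := (tendsto_eval_div_pow g.num (natDegree_num_le hM)).div
    (tendsto_eval_div_pow g.denom le_rfl)
    (by simpa using g.denom_ne_zero)
  rw [Complex.ofReal_div]
  refine h1.congr' ?_
  have := (isCompact_singleton (x := (0 : ℂ))).compl_mem_cocompact
  filter_upwards [this] with s hs
  exact div_div_div_cancel_right₀ (pow_ne_zero _ hs) _ _

end Rational

/-! ### Continuity and limits of `RH_∞` matrices on the closed right half-plane. -/

section RHInfty

open ComplexConjugate

variable {n : ℕ} {G : TransferMatrix n}

theorem IsRHInfty.entry_bounded (hG : IsRHInfty G) :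
    ∃ M : ℝ, ∀ i k, ∀ s : ℂ, 0 < s.re → ‖(G i k).eval (algebraMap ℝ ℂ) s‖ ≤ M := by
  obtain ⟨M, hM⟩ := hG.bounded
  exact ⟨M, fun i k s hs => hM s hs i k⟩

theorem IsRHInfty.continuousAt (hG : IsRHInfty G) {s : ℂ} (hs : 0 ≤ s.re) :
    ContinuousAt (TransferMatrix.at G) s := by
  obtain ⟨M, hM⟩ := hG.entry_bounded
  exact continuousAt_pi.2 fun i => continuousAt_pi.2 fun k =>
    continuousAt_ratFunc_eval (hM i k) hs

theorem IsRHInfty.exists_tendsto (hG : IsRHInfty G) :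
    ∃ L : Matrix (Fin n) (Fin n) ℝ,
      Tendsto (TransferMatrix.at G) (cocompact ℂ) (𝓝 (L.map (algebraMap ℝ ℂ))) := by
  obtain ⟨M, hM⟩ := hG.entry_bounded
  choose L hL using fun i k => exists_tendsto_ratFunc_eval (hM i k)
  exact ⟨Matrix.of L, tendsto_pi_nhds.2 fun i => tendsto_pi_nhds.2 fun k => hL i k⟩

theorem tendsto_I_mul_cocompact :
    Tendsto (fun ω : ℝ => Complex.I * (ω : ℂ)) atTop (cocompact ℂ) := by
  rw [← Metric.cobounded_eq_cocompact, ← tendsto_norm_atTop_iff_cobounded]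
  simpa using tendsto_abs_atTop_atTop

/-- A proper rational function has the same limit in every direction, so the limit along the
imaginary axis also serves for sequences inside the strip. -/
theorem IsRHInfty.tendsto_atInfty (hG : IsRHInfty G) :
    Tendsto (TransferMatrix.at G) (cocompact ℂ) (𝓝 (TransferMatrix.atInfty G)) := by
  obtain ⟨L, hL⟩ := hG.exists_tendsto
  have : TransferMatrix.atInfty G = L.map (algebraMap ℝ ℂ) :=
    (hL.comp tendsto_I_mul_cocompact).limUnder_eq
  rwa [this]

/-- The limit is a real matrix. This makes the plain transpose in `quadForm` a conjugate transpose,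
so that it evaluates a Hermitian form. -/
theorem IsRHInfty.conjTranspose_atInfty (hG : IsRHInfty G) :
    (TransferMatrix.atInfty G)ᴴ = (TransferMatrix.atInfty G)ᵀ := by
  obtain ⟨L, hL⟩ := hG.exists_tendsto
  rw [tendsto_nhds_unique hG.tendsto_atInfty hL]
  ext i k
  simp

theorem TransferMatrix.at_conj (G : TransferMatrix n) (s : ℂ) :
    TransferMatrix.at G (conj s) = (TransferMatrix.at G s).map conj := by
  ext i k
  exact ratFunc_eval_conj _ _

theorem TransferMatrix.conjTranspose_at_zero (G : TransferMatrix n) :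
    (TransferMatrix.at G 0)ᴴ = (TransferMatrix.at G 0)ᵀ := by
  have h := TransferMatrix.at_conj G 0
  rw [map_zero] at h
  conv_rhs => rw [h]
  rfl

end RHInfty

/-! ### Nonsingularity of the loop at each frequency, and its uniformity. -/

section Frequency

open ComplexConjugate

variable {n : ℕ} {P C : TransferMatrix n}

/-- For every `τ ∈ [0, 1]`, the loop equations `w = P v`, `v = τ C w` have only the trivial
solution. -/
def LoopNonsingular (P C : Matrix (Fin n) (Fin n) ℂ) : Prop :=
  ∀ τ ∈ Icc (0 : ℝ) 1, ∀ v w : Fin n → ℂ, w = P *ᵥ v → v = (τ : ℂ) • (C *ᵥ w) → v = 0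

theorem dotProduct_I_smul_sub_conjTranspose (A : Matrix (Fin n) (Fin n) ℂ) (v : Fin n → ℂ) :
    star v ⬝ᵥ ((Complex.I • (A - Aᴴ)) *ᵥ v) = ((-2 * (star v ⬝ᵥ (A *ᵥ v)).im : ℝ) : ℂ) := by
  have h : star v ⬝ᵥ (Aᴴ *ᵥ v) = conj (star v ⬝ᵥ (A *ᵥ v)) := by
    rw [starRingEnd_apply, Matrix.star_dotProduct, Matrix.star_mulVec,
      Matrix.conjTranspose_conjTranspose, Matrix.dotProduct_mulVec]
  rw [Matrix.smul_mulVec, dotProduct_smul, Matrix.sub_mulVec, dotProduct_sub, h,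
    Complex.sub_conj, smul_eq_mul]
  push_cast
  linear_combination (2 * ((star v ⬝ᵥ (A *ᵥ v)).im : ℂ)) * Complex.I_mul_I

/-- For a loop solution, `v*Av = v*w = τ conj(w*Bw)`. The left side has negative imaginary part if
`v ≠ 0`, the right side a nonnegative one. -/
theorem loopNonsingular_of_ni {A B : Matrix (Fin n) (Fin n) ℂ}
    (hA : (Complex.I • (A - Aᴴ)).PosDef) (hB : (Complex.I • (B - Bᴴ)).PosSemidef) :
    LoopNonsingular A B := by
  intro τ hτ v w hw hv
  by_contra hv0
  have h1 := hA.dotProduct_mulVec_pos hv0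
  have h2 := hB.dotProduct_mulVec_nonneg w
  rw [dotProduct_I_smul_sub_conjTranspose] at h1 h2
  rw [← Complex.ofReal_zero, Complex.real_lt_real] at h1
  rw [← Complex.ofReal_zero, Complex.real_le_real] at h2
  have h3 : star v ⬝ᵥ (A *ᵥ v) = τ * conj (star w ⬝ᵥ (B *ᵥ w)) := by
    rw [← hw, starRingEnd_apply]
    nth_rewrite 1 [hv]
    rw [star_smul, smul_dotProduct, smul_eq_mul, Matrix.star_dotProduct]
    simp
  rw [h3, Complex.im_ofReal_mul, Complex.conj_im] at h1
  nlinarith [mul_nonneg hτ.1 h2]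

/-- The loop equations say that `[Av; v] = [w; τBw]`, and the form of `Ξ` would be both negative and
nonnegative on this vector. -/
theorem loopNonsingular_of_quadForm {A B : Matrix (Fin n) (Fin n) ℂ}
    {Ξ : Matrix (Fin n ⊕ Fin n) (Fin n ⊕ Fin n) ℂ} (hA : Aᴴ = Aᵀ) (hB : Bᴴ = Bᵀ)
    (h1 : (-(quadForm Ξ A 1)).PosDef)
    (h2 : ∀ τ ∈ Icc (0 : ℝ) 1, (quadForm Ξ 1 ((τ : ℂ) • B)).PosSemidef) :
    LoopNonsingular A B := by
  intro τ hτ v w hw hv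
  by_contra hv0
  have h3 := h1.dotProduct_mulVec_pos hv0
  have h4 := (h2 τ hτ).dotProduct_mulVec_nonneg w
  have key (X Y : Matrix (Fin n) (Fin n) ℂ) (hX : Xᴴ = Xᵀ) (hY : Yᴴ = Yᵀ) (x : Fin n → ℂ) :
      star x ⬝ᵥ (quadForm Ξ X Y *ᵥ x) =
        star (Sum.elim (X *ᵥ x) (Y *ᵥ x)) ⬝ᵥ (Ξ *ᵥ Sum.elim (X *ᵥ x) (Y *ᵥ x)) := by
    have h5 : (stack X Y)ᵀ = (stack X Y)ᴴ := by
      rw [stack, Matrix.transpose_fromRows, Matrix.conjTranspose_fromRows_eq_fromCols_conjTranspose,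
        hX, hY]
    rw [← Matrix.fromRows_mulVec, quadForm, h5, ← Matrix.mulVec_mulVec, ← Matrix.mulVec_mulVec,
      Matrix.star_mulVec, Matrix.dotProduct_mulVec, stack]
  rw [Matrix.neg_mulVec, dotProduct_neg, key A 1 hA (by simp), Matrix.one_mulVec, ← hw] at h3
  rw [key 1 _ (by simp) (by simp [hB]), Matrix.one_mulVec, Matrix.smul_mulVec, ← hv] at h4
  have := add_pos_of_pos_of_nonneg h3 h4
  simp at this

theorem loopNonsingular_map_conj {A B : Matrix (Fin n) (Fin n) ℂ} (h : LoopNonsingular A B) :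
    LoopNonsingular (A.map conj) (B.map conj) := by
  intro τ hτ v w hw hv
  have key (X : Matrix (Fin n) (Fin n) ℂ) (x : Fin n → ℂ) :
      star (X.map conj *ᵥ x) = X *ᵥ star x := by
    ext i
    simp [Matrix.mulVec, dotProduct]
  have := h τ hτ (star v) (star w) (by rw [hw, key])
    (by conv_lhs => rw [hv, star_smul, key]
        simp)
  simpa using this

theorem loopNonsingular_imaginary_axis (hP : IsSNI P) (hC : IsNI C)
    (h0 : LoopNonsingular (TransferMatrix.at P 0) (TransferMatrix.at C 0)) (ω : ℝ) :
    LoopNonsingular (TransferMatrix.at P (Complex.I * ω)) (TransferMatrix.at C (Complex.I * ω)) := by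
  rcases lt_trichotomy ω 0 with hω | rfl | hω
  · have hconj : Complex.I * (ω : ℂ) = conj (Complex.I * ((-ω : ℝ) : ℂ)) := by simp
    rw [hconj, TransferMatrix.at_conj, TransferMatrix.at_conj]
    exact loopNonsingular_map_conj
      (loopNonsingular_of_ni (hP.pos _ (by linarith)) (hC.nonneg _ (by linarith)))
  · simpa using h0
  · exact loopNonsingular_of_ni (hP.pos ω hω) (hC.nonneg ω hω)

open WithLp in
-- Were there no such `ε`, unit vectors with residual tending to `0` at points with `Re s → 0` would
-- produce, in the limit, a nontrivial loop solution on the axis or at infinity.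
theorem exists_uniform_lower_bound (hP : IsRHInfty P) (hC : IsRHInfty C)
    (haxis : ∀ ω : ℝ, LoopNonsingular (TransferMatrix.at P (Complex.I * ω))
      (TransferMatrix.at C (Complex.I * ω)))
    (hinf : LoopNonsingular (TransferMatrix.atInfty P) (TransferMatrix.atInfty C)) :
    ∃ ε > 0, ∀ s : ℂ, 0 < s.re → s.re < ε → ∀ τ ∈ Icc (0 : ℝ) 1, ∀ v : Fin n → ℂ,
      ε * ‖toLp 2 v‖ ≤
        ‖toLp 2 (v - (τ : ℂ) • (TransferMatrix.at C s *ᵥ (TransferMatrix.at P s *ᵥ v)))‖ := by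
  by_contra! hcon
  have hpos (k : ℕ) : (0 : ℝ) < 1 / ((k : ℝ) + 1) := by positivity
  choose s hs0 hs1 τ hτ v hv using fun k : ℕ => hcon _ (hpos k)
  have hv0 (k : ℕ) : 0 < ‖toLp 2 (v k)‖ := by
    rw [norm_pos_iff]
    intro h
    have hvk : v k = 0 := by simpa using h
    have := hv k
    simp [hvk] at this
  set x : ℕ → EuclideanSpace ℂ (Fin n) := fun k => ((‖toLp 2 (v k)‖⁻¹ : ℝ) : ℂ) • toLp 2 (v k)
    with hx
  have hx1 (k : ℕ) : x k ∈ Metric.sphere (0 : EuclideanSpace ℂ (Fin n)) 1 := by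
    simp [hx, norm_smul, (hv0 k).ne']
  have hx2 (k : ℕ) : ‖x k - toLp 2 ((τ k : ℂ) • (TransferMatrix.at C (s k) *ᵥ
      (TransferMatrix.at P (s k) *ᵥ ofLp (x k))))‖ ≤ 1 / ((k : ℝ) + 1) := by
    have : x k - toLp 2 ((τ k : ℂ) • (TransferMatrix.at C (s k) *ᵥ
      (TransferMatrix.at P (s k) *ᵥ ofLp (x k)))) = ((‖toLp 2 (v k)‖⁻¹ : ℝ) : ℂ) •
        toLp 2 (v k - (τ k : ℂ) • (TransferMatrix.at C (s k) *ᵥ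
          (TransferMatrix.at P (s k) *ᵥ v k))) := by
      simp only [hx, toLp_sub, smul_sub, toLp_smul, ofLp_smul, Matrix.mulVec_smul]
      rw [smul_comm]
    rw [this, norm_smul, Complex.norm_real, norm_inv, norm_norm, inv_mul_le_iff₀ (hv0 k), mul_comm]
    exact (hv k).le
  -- Along an ultrafilter a sequence in `ℂ` either tends to infinity or lies eventually in a compact
  -- set and converges, so no subsequences are needed.
  let u : Ultrafilter ℕ := Filter.hyperfilter ℕ
  have hu : (u : Filter ℕ) ≤ atTop := by
    rw [← Nat.cofinite_eq_atTop]; exact Filter.hyperfilter_le_cofinite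
  obtain ⟨x₀, hx₀, hxlim⟩ := (isCompact_sphere (0 : EuclideanSpace ℂ (Fin n)) 1).ultrafilter_le_nhds
    (u.map x) (le_principal_iff.2 (Eventually.of_forall hx1 : ∀ᶠ k in (u : Filter ℕ), _))
  obtain ⟨τ₀, hτ₀, hτlim⟩ := (isCompact_Icc (a := (0 : ℝ)) (b := 1)).ultrafilter_le_nhds
    (u.map τ) (le_principal_iff.2 (Eventually.of_forall hτ : ∀ᶠ k in (u : Filter ℕ), _))
  obtain ⟨A, B, hAB, hA, hB⟩ : ∃ A B : Matrix (Fin n) (Fin n) ℂ, LoopNonsingular A B ∧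
      Tendsto (fun k => TransferMatrix.at P (s k)) u (𝓝 A) ∧
      Tendsto (fun k => TransferMatrix.at C (s k)) u (𝓝 B) := by
    by_cases hsinf : Tendsto s u (cocompact ℂ)
    · exact ⟨_, _, hinf, hP.tendsto_atInfty.comp hsinf, hC.tendsto_atInfty.comp hsinf⟩
    · rw [(hasBasis_cocompact).tendsto_right_iff] at hsinf
      push Not at hsinf
      obtain ⟨K, hK, hsK⟩ := hsinf
      have hsK' : ∀ᶠ k in u, s k ∈ K := by simpa using hsK
      obtain ⟨a, -, ha⟩ := hK.ultrafilter_le_nhds' (u.map s) hsK'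
      have hre : a.re = 0 := by
        have h1 : Tendsto (fun k => (s k).re) u (𝓝 a.re) :=
          (Complex.continuous_re.tendsto a).comp ha
        have h2 : Tendsto (fun k => (s k).re) u (𝓝 0) :=
          (squeeze_zero (fun k => (hs0 k).le) (fun k => (hs1 k).le)
            tendsto_one_div_add_atTop_nhds_zero_nat).mono_left hu
        exact tendsto_nhds_unique h1 h2
      have haI : a = Complex.I * (a.im : ℂ) := by
        apply Complex.ext <;> simp [hre]
      have hax := haxis a.im
      rw [← haI] at hax
      exact ⟨_, _, hax, (hP.continuousAt hre.ge).tendsto.comp ha,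
        (hC.continuousAt hre.ge).tendsto.comp ha⟩
  have hcont : Continuous fun z : (ℝ × EuclideanSpace ℂ (Fin n)) ×
      (Matrix (Fin n) (Fin n) ℂ × Matrix (Fin n) (Fin n) ℂ) =>
      ‖z.1.2 - toLp 2 ((z.1.1 : ℂ) • (z.2.2 *ᵥ (z.2.1 *ᵥ ofLp z.1.2)))‖ := by
    fun_prop
  have hlim := (hcont.tendsto ((τ₀, x₀), (A, B))).comp
    ((Tendsto.prodMk_nhds (f := (u : Filter ℕ)) hτlim hxlim).prodMk_nhds (hA.prodMk_nhds hB))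
  have hle := le_of_tendsto_of_tendsto hlim
    (tendsto_one_div_add_atTop_nhds_zero_nat.mono_left hu) (Eventually.of_forall hx2)
  have hzero := norm_le_zero_iff.1 hle
  have hx₀0 := hAB τ₀ hτ₀ (ofLp x₀) _ rfl (by simpa using congrArg ofLp (sub_eq_zero.1 hzero))
  have : x₀ = 0 := by simpa using hx₀0
  simp [this] at hx₀

end Frequency

/-! ### The Laplace transform on vertical lines and the `L₂` norm. -/

section LaplacePlancherel

open WithLp
open scoped FourierTransform

variable {n : ℕ}

/-- The point `σ + 2πjω` of the complex plane. -/
def verticalLine (σ ω : ℝ) : ℂ := σ + 2 * Real.pi * ω * Complex.I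

@[simp]
theorem verticalLine_re (σ ω : ℝ) : (verticalLine σ ω).re = σ := by
  simp [verticalLine]

/-- The signal `e^{-σt} u(t)`. -/
def damp (σ : ℝ) (u : Signal n) (t : ℝ) : EuclideanSpace ℝ (Fin n) := Real.exp (-(σ * t)) • u t

theorem aestronglyMeasurable_damp (σ : ℝ) (u : Signal n) :
    AEStronglyMeasurable (damp σ u) timeMeasure :=
  (by fun_prop : Continuous fun t : ℝ => Real.exp (-(σ * t))).aestronglyMeasurable.smul
    u.aestronglyMeasurable

/-- Plancherel's theorem for the Laplace transform on a vertical line. -/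
theorem eLpNorm_laplace {σ : ℝ} {u : Signal n} (hu : LaplaceConverges u σ) :
    eLpNorm (fun ω : ℝ => toLp 2 (laplace u (verticalLine σ ω))) 2 volume =
      eLpNorm (damp σ u) 2 timeMeasure := by
  set h : ℝ → EuclideanSpace ℂ (Fin n) :=
    fun t => toLp 2 fun i => Complex.exp (-((σ : ℂ) * t)) * ((u t i : ℝ) : ℂ) with hh
  have hint : Integrable h timeMeasure := Integrable.of_eval_piLp hu
  have hf : Integrable ((Ici 0).indicator h) :=
    (integrable_indicator_iff measurableSet_Ici).2 hint
  have hF : 𝓕 ((Ici 0).indicator h) = fun ω : ℝ => toLp 2 (laplace u (verticalLine σ ω)) := by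
    funext ω
    rw [Real.fourier_real_eq_integral_exp_smul]
    have h1 : ∀ t : ℝ, Complex.exp (↑(-2 * Real.pi * t * ω) * Complex.I) • (Ici 0).indicator h t =
        (Ici 0).indicator
          (fun t => Complex.exp (↑(-2 * Real.pi * t * ω) * Complex.I) • h t) t := by
      intro t
      by_cases ht : t ∈ Ici (0 : ℝ) <;> simp [ht]
    simp_rw [h1]
    rw [integral_indicator measurableSet_Ici]
    have h2 : Integrable (fun t : ℝ => Complex.exp (↑(-2 * Real.pi * t * ω) * Complex.I) • h t)
        timeMeasure := by
      have hcont : Continuous fun t : ℝ =>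
          Complex.exp (↑(-2 * Real.pi * t * ω) * Complex.I) := by fun_prop
      refine hint.bdd_smul 1 hcont.aestronglyMeasurable ?_
      exact Eventually.of_forall fun t => (Complex.norm_exp_ofReal_mul_I _).le
    ext i
    rw [show volume.restrict (Ici (0 : ℝ)) = timeMeasure from rfl,
      eval_integral_piLp fun i => h2.eval_piLp i]
    refine integral_congr_ae (Eventually.of_forall fun t => ?_)
    simp only [hh, PiLp.smul_apply, smul_eq_mul, ← mul_assoc, ← Complex.exp_add]
    congr 2
    simp only [verticalLine]
    push_cast
    ring
  rw [← hF, eLpNorm_fourier_eq hf, eLpNorm_indicator_eq_eLpNorm_restrict measurableSet_Ici]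
  refine eLpNorm_congr_norm_ae (Eventually.of_forall fun t => ?_)
  have h3 : h t = Complex.exp (-((σ : ℂ) * t)) • toLp 2 fun i => ((u t i : ℝ) : ℂ) := by
    ext i; simp [hh]
  rw [h3, damp, norm_smul, norm_smul, Complex.norm_exp]
  simp [EuclideanSpace.norm_eq]

theorem eLpNorm_damp_le {σ : ℝ} (hσ : 0 ≤ σ) (u : Signal n) :
    eLpNorm (damp σ u) 2 timeMeasure ≤ l2norm u := by
  refine eLpNorm_mono_ae ?_
  filter_upwards [ae_restrict_mem measurableSet_Ici] with t (ht : 0 ≤ t)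
  rw [damp, norm_smul, Real.norm_eq_abs, Real.abs_exp]
  refine mul_le_of_le_one_left (norm_nonneg _) (Real.exp_le_one_iff.2 ?_)
  have := mul_nonneg hσ ht
  linarith

/-- Fatou's lemma as `σ → 0`. Frequency-domain estimates are therefore needed only for small
positive `σ`. -/
theorem l2norm_le_of_damp {u : Signal n} {K : ℝ≥0∞}
    (h : ∀ᶠ σ in 𝓝[>] (0 : ℝ), eLpNorm (damp σ u) 2 timeMeasure ≤ K) : l2norm u ≤ K := by
  obtain ⟨σ, hσ⟩ := exists_seq_tendsto (𝓝[>] (0 : ℝ))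
  have hσ0 : Tendsto σ atTop (𝓝 0) := hσ.mono_right nhdsWithin_le_nhds
  refine (Lp.eLpNorm_lim_le_liminf_eLpNorm (f := fun k => damp (σ k) u)
    (fun k => aestronglyMeasurable_damp _ _) (u : ℝ → EuclideanSpace ℝ (Fin n)) ?_).trans ?_
  · refine Eventually.of_forall fun t => ?_
    have h1 : Continuous fun r : ℝ => Real.exp (-(r * t)) • u t := by fun_prop
    simpa [damp, Function.comp_def] using (h1.tendsto 0).comp hσ0
  · refine liminf_le_of_le (by isBoundedDefault) fun b hb => ?_
    obtain ⟨k, h1, h2⟩ := (hb.and (hσ.eventually h)).exists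
    exact h1.trans h2

theorem InL2.laplaceConverges {u : Signal n} (hu : InL2 u) {s : ℂ} (hs : 0 < s.re) :
    LaplaceConverges u s := by
  intro i
  have h1 : MemLp (fun t : ℝ => Complex.exp (-(s * t))) 2 timeMeasure := by
    rw [memLp_two_iff_integrable_sq_norm (Continuous.aestronglyMeasurable (by fun_prop))]
    have h2 := integrableOn_exp_mul_Ioi (a := -(2 * s.re)) (by linarith) 0
    rw [← integrableOn_Ici_iff_integrableOn_Ioi] at h2
    refine h2.congr (Eventually.of_forall fun t => ?_)
    simp only [Complex.norm_exp, ← Real.exp_nat_mul]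
    congr 1
    simp
    ring
  have h3 : MemLp (fun t => ((u t i : ℝ) : ℂ)) 2 timeMeasure :=
    (MemLp.eval_piLp hu i).ofReal
  exact h1.integrable_mul h3

theorem laplace_sub_smul {u v : Signal n} {s : ℂ} (hu : LaplaceConverges u s)
    (hv : LaplaceConverges v s) (c : ℝ) :
    laplace (u - c • v) s = laplace u s - (c : ℂ) • laplace v s := by
  funext i
  have : laplace (u - c • v) s i = ∫ t, (Complex.exp (-(s * t)) * ((u t i : ℝ) : ℂ) -
      (c : ℂ) * (Complex.exp (-(s * t)) * ((v t i : ℝ) : ℂ))) ∂timeMeasure := by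
    refine integral_congr_ae ?_
    filter_upwards [AEEqFun.coeFn_sub u (c • v), AEEqFun.coeFn_smul c v] with t h1 h2
    rw [h1, Pi.sub_apply, h2]
    simp
    ring
  rw [this, integral_sub (hu i) ((hv i).const_mul _), integral_const_mul]
  rfl

/-- The constant is crude, with `n + 1` standing in for `√n`; what matters is that it depends only
on `n` and `M`. -/
theorem norm_toLp_mulVec_le {A : Matrix (Fin n) (Fin n) ℂ} {M : ℝ} (hA : ∀ i k, ‖A i k‖ ≤ M)
    (v : Fin n → ℂ) : ‖toLp 2 (A *ᵥ v)‖ ≤ (n + 1) * (n * |M|) * ‖toLp 2 v‖ := by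
  have h1 (i : Fin n) : ‖(A *ᵥ v) i‖ ≤ n * |M| * ‖toLp 2 v‖ := by
    calc ‖(A *ᵥ v) i‖ = ‖∑ k, A i k * v k‖ := rfl
      _ ≤ ∑ k, ‖A i k * v k‖ := norm_sum_le _ _
      _ ≤ ∑ _k : Fin n, |M| * ‖toLp 2 v‖ := by
        refine Finset.sum_le_sum fun k _ => ?_
        rw [norm_mul]
        exact mul_le_mul ((hA i k).trans (le_abs_self M)) (PiLp.norm_apply_le (toLp 2 v) k)
          (norm_nonneg _) (abs_nonneg _)
      _ = n * |M| * ‖toLp 2 v‖ := by simp [mul_assoc]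
  rw [EuclideanSpace.norm_eq]
  refine Real.sqrt_le_iff.2 ⟨by positivity, ?_⟩
  calc ∑ i, ‖(A *ᵥ v) i‖ ^ 2 ≤ ∑ _i : Fin n, (n * |M| * ‖toLp 2 v‖) ^ 2 :=
        Finset.sum_le_sum fun i _ => pow_le_pow_left₀ (norm_nonneg _) (h1 i) 2
    _ = n * (n * |M| * ‖toLp 2 v‖) ^ 2 := by simp
    _ ≤ (n + 1) ^ 2 * (n * |M| * ‖toLp 2 v‖) ^ 2 := by
        refine mul_le_mul_of_nonneg_right ?_ (sq_nonneg _)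
        nlinarith [(Nat.cast_nonneg n : (0 : ℝ) ≤ n)]
    _ = ((n + 1) * (n * |M|) * ‖toLp 2 v‖) ^ 2 := by ring

end LaplacePlancherel

/-! ### From frequency-domain bounds to `L₂` bounds. -/

section Gain

open WithLp

variable {n : ℕ} {P C : System n} {Phat Chat : TransferMatrix n}

/-- A system with an `RH_∞` transfer matrix has finite gain on `L₂`. -/
theorem IsLTIWithTransferMatrix.exists_gain (hP : IsLTIWithTransferMatrix P Phat)
    (hR : IsRHInfty Phat) : ∃ K : ℝ, 0 ≤ K ∧ ∀ u : L2e n, InL2 (u : Signal n) →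
      l2norm (P u : Signal n) ≤ ENNReal.ofReal K * l2norm (u : Signal n) := by
  obtain ⟨M, hM⟩ := hR.bounded
  refine ⟨(n + 1) * (n * |M|), by positivity, fun u hu => l2norm_le_of_damp ?_⟩
  filter_upwards [self_mem_nhdsWithin] with σ (hσ : 0 < σ)
  rw [← eLpNorm_laplace (hP.transfer u hu σ hσ).1]
  calc _ ≤ ENNReal.ofReal ((n + 1) * (n * |M|)) *
        eLpNorm (fun ω : ℝ => toLp 2 (laplace (u : Signal n) (verticalLine σ ω))) 2 volume := by
        refine eLpNorm_le_mul_eLpNorm_of_ae_le_mul (Eventually.of_forall fun ω => ?_) _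
        rw [(hP.transfer u hu _ (by simpa using hσ)).2]
        exact norm_toLp_mulVec_le (hM _ (by simpa using hσ)) _
    _ ≤ _ := by
        rw [eLpNorm_laplace (hu.laplaceConverges (by simpa using hσ))]
        gcongr
        exact eLpNorm_damp_le hσ.le _

theorem IsLTIWithTransferMatrix.inL2 (hP : IsLTIWithTransferMatrix P Phat)
    (hR : IsRHInfty Phat) {u : L2e n} (hu : InL2 (u : Signal n)) : InL2 (P u : Signal n) := by
  obtain ⟨K, -, hK⟩ := hP.exists_gain hR
  exact ⟨AEEqFun.aestronglyMeasurable _,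
    (hK u hu).trans_lt (ENNReal.mul_lt_top ENNReal.ofReal_lt_top hu.2)⟩

/-- The return difference `1 - τ C P` is bounded below on `L₂`, uniformly in `τ ∈ [0, 1]`. -/
theorem exists_return_difference_bound (hP : IsLTIWithTransferMatrix P Phat)
    (hC : IsLTIWithTransferMatrix C Chat) (hRP : IsRHInfty Phat) (hRC : IsRHInfty Chat)
    (haxis : ∀ ω : ℝ, LoopNonsingular (TransferMatrix.at Phat (Complex.I * ω))
      (TransferMatrix.at Chat (Complex.I * ω)))
    (hinf : LoopNonsingular (TransferMatrix.atInfty Phat) (TransferMatrix.atInfty Chat)) :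
    ∃ K : ℝ, 0 < K ∧ ∀ τ ∈ Icc (0 : ℝ) 1, ∀ u : L2e n, InL2 (u : Signal n) →
      l2norm (u : Signal n) ≤ ENNReal.ofReal K * l2norm ((u - τ • C (P u) : L2e n) : Signal n) := by
  obtain ⟨ε, hε, hbound⟩ := exists_uniform_lower_bound hRP hRC haxis hinf
  refine ⟨ε⁻¹, by positivity, fun τ hτ u hu => l2norm_le_of_damp ?_⟩
  -- Only lines inside the strip `0 < Re s < ε` are used, where the pointwise lower bound holds.
  filter_upwards [Ioo_mem_nhdsGT hε] with σ hσ
  have hPu := hP.inL2 hRP hu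
  have hCPu := hC.inL2 hRC hPu
  have hw : InL2 ((u - τ • C (P u) : L2e n) : Signal n) :=
    (memLp_congr_ae (AEEqFun.coeFn_sub _ _)).2
      (hu.sub ((memLp_congr_ae (AEEqFun.coeFn_smul _ _)).2 (hCPu.const_smul τ)))
  have hre : 0 < (σ : ℂ).re := by simpa using hσ.1
  rw [← eLpNorm_laplace (hu.laplaceConverges hre)]
  calc _ ≤ ENNReal.ofReal ε⁻¹ * eLpNorm (fun ω : ℝ => toLp 2
          (laplace ((u - τ • C (P u) : L2e n) : Signal n) (verticalLine σ ω))) 2 volume := by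
        refine eLpNorm_le_mul_eLpNorm_of_ae_le_mul (Eventually.of_forall fun ω => ?_) _
        have hs : 0 < (verticalLine σ ω).re := by simpa using hσ.1
        have h1 := hbound _ hs (by simpa using hσ.2) τ hτ (laplace (u : Signal n) (verticalLine σ ω))
        rw [← (hP.transfer u hu _ hs).2, ← (hC.transfer _ hPu _ hs).2,
          ← laplace_sub_smul (hu.laplaceConverges hs) (hCPu.laplaceConverges hs)] at h1
        rw [inv_mul_eq_div, le_div_iff₀' hε]
        exact h1
    _ ≤ _ := by
        rw [eLpNorm_laplace (hw.laplaceConverges hre)]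
        gcongr
        exact eLpNorm_damp_le hσ.1.le _

end Gain

/-! ### Invertibility by continuation in a Banach algebra. -/

section Continuation

/-- The operators that map each member of a family of subspaces into itself. -/
def invariantSubalgebra {ι X : Type*} [NormedAddCommGroup X] [NormedSpace ℝ X]
    (V : ι → Submodule ℝ X) : Subalgebra ℝ (X →L[ℝ] X) where
  carrier := {A | ∀ i, ∀ u ∈ V i, A u ∈ V i}
  mul_mem' hA hB i u hu := hA i _ (hB i u hu)
  add_mem' hA hB i u hu := (V i).add_mem (hA i u hu) (hB i u hu)
  algebraMap_mem' c i u hu := by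
    rw [Algebra.algebraMap_eq_smul_one]
    exact (V i).smul_mem c hu

/-- Closedness gives completeness, so inverses found by perturbation within the subalgebra remain in
it. -/
theorem isClosed_invariantSubalgebra {ι X : Type*} [NormedAddCommGroup X] [NormedSpace ℝ X]
    (V : ι → Submodule ℝ X) (hV : ∀ i, IsClosed (V i : Set X)) :
    IsClosed (invariantSubalgebra V : Set (X →L[ℝ] X)) := by
  have : (invariantSubalgebra V : Set (X →L[ℝ] X)) =
      ⋂ i, ⋂ u ∈ V i, (fun A : X →L[ℝ] X => A u) ⁻¹' (V i) := by
    ext A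
    simp only [mem_iInter, mem_preimage, SetLike.mem_coe]
    rfl
  rw [this]
  exact isClosed_iInter fun i => isClosed_biInter fun u _ =>
    (hV i).preimage (ContinuousLinearMap.apply ℝ X u).continuous

/-- Continuation: if all right inverses of `1 - τ a`, `τ ∈ [0, 1]`, obey a common bound, then
`1 - a` is invertible. -/
theorem isUnit_one_sub_of_inverse_bound {𝒜 : Type*} [NormedRing 𝒜] [NormedAlgebra ℝ 𝒜]
    [CompleteSpace 𝒜] (a : 𝒜) {K : ℝ} (hK : 0 < K)
    (h : ∀ τ ∈ Icc (0 : ℝ) 1, ∀ b : 𝒜, (1 - τ • a) * b = 1 → ‖b‖ ≤ K) : IsUnit (1 - a) := by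
  rcases subsingleton_or_nontrivial 𝒜 with h𝒜 | h𝒜
  · exact isUnit_of_subsingleton _
  -- Steps of length `1/N` in `τ` change the element by `‖a‖/N < 1/K`, which is within the radius
  -- `1/‖x⁻¹‖` where invertibility persists. The common bound `K` keeps this radius from shrinking.
  obtain ⟨N, hN⟩ := exists_nat_gt (‖a‖ * K)
  have hN0 : (0 : ℝ) < N := lt_of_le_of_lt (by positivity) hN
  have key : ∀ k : ℕ, k ≤ N → IsUnit (1 - ((k : ℝ) / N) • a) := by
    intro k
    induction k with
    | zero => simp
    | succ k ih =>
      intro hk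
      obtain ⟨x, hx⟩ := ih (by omega)
      have hkN : (k : ℝ) ≤ N := by exact_mod_cast (by omega : k ≤ N)
      have hb : ‖(↑x⁻¹ : 𝒜)‖ ≤ K :=
        h (k / N) ⟨by positivity, (div_le_one hN0).2 hkN⟩ _ (by rw [← hx, Units.mul_inv])
      have hdiff : (1 - (((k + 1 : ℕ) : ℝ) / N) • a) - x = -((1 / (N : ℝ)) • a) := by
        rw [hx, sub_sub_sub_cancel_left, ← sub_smul, ← neg_smul]
        congr 1
        push_cast
        ring
      refine (x.ofNearby _ ?_).isUnit
      rw [hdiff, norm_neg, norm_smul, Real.norm_eq_abs, abs_of_pos (by positivity)]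
      have hx0 : 0 < ‖(↑x⁻¹ : 𝒜)‖ := norm_pos_iff.2 (Units.ne_zero _)
      calc 1 / (N : ℝ) * ‖a‖ < K⁻¹ := by
            rw [one_div_mul_eq_div, div_lt_iff₀ hN0, inv_mul_eq_div, lt_div_iff₀ hK]
            exact hN
        _ ≤ _ := inv_anti₀ hx0 hb
  have := key N le_rfl
  rwa [div_self hN0.ne', one_smul] at this

end Continuation

/-! ### Truncation on `L₂ₑ` and gluing of signals. -/

section Truncation

variable {n : ℕ}

theorem truncSignal_eq_iff {T : ℝ} {u v : Signal n} :
    truncSignal T u = truncSignal T v ↔ ∀ᵐ t ∂timeMeasure, t ∈ Icc 0 T → u t = v t := by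
  constructor
  · intro h
    filter_upwards [coeFn_truncSignal T u, coeFn_truncSignal T v] with t h1 h2 ht
    rw [h] at h1
    rw [h1, indicator_of_mem ht, indicator_of_mem ht] at h2
    exact h2
  · intro h
    apply AEEqFun.ext
    filter_upwards [coeFn_truncSignal T u, coeFn_truncSignal T v, h] with t h1 h2 h3
    rw [h1, h2]
    by_cases ht : t ∈ Icc 0 T
    · simp [ht, h3 ht]
    · simp [ht]

theorem truncSignal_truncSignal_of_le {S T : ℝ} (h : S ≤ T) (u : Signal n) :
    truncSignal S (truncSignal T u) = truncSignal S u := by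
  rw [truncSignal_eq_iff]
  filter_upwards [coeFn_truncSignal T u] with t h1 ht
  have ht' : t ∈ Icc 0 T := ⟨ht.1, ht.2.trans h⟩
  rw [h1, indicator_of_mem ht']

theorem truncSignal_add (T : ℝ) (u v : Signal n) :
    truncSignal T (u + v) = truncSignal T u + truncSignal T v := by
  apply AEEqFun.ext
  filter_upwards [coeFn_truncSignal T (u + v), coeFn_truncSignal T u, coeFn_truncSignal T v,
    AEEqFun.coeFn_add u v, AEEqFun.coeFn_add (truncSignal T u) (truncSignal T v)]
    with t h1 h2 h3 h4 h5
  rw [h1, h5, Pi.add_apply, h2, h3]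
  by_cases ht : t ∈ Icc 0 T <;> simp [ht, h4]

theorem truncSignal_smul (T : ℝ) (c : ℝ) (u : Signal n) :
    truncSignal T (c • u) = c • truncSignal T u := by
  apply AEEqFun.ext
  filter_upwards [coeFn_truncSignal T (c • u), coeFn_truncSignal T u,
    AEEqFun.coeFn_smul c u, AEEqFun.coeFn_smul c (truncSignal T u)] with t h1 h2 h3 h4
  rw [h1, h4, Pi.smul_apply, h2]
  by_cases ht : t ∈ Icc 0 T <;> simp [ht, h3]

theorem l2norm_truncSignal_le (T : ℝ) (u : Signal n) : l2norm (truncSignal T u) ≤ l2norm u := by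
  rw [l2norm, eLpNorm_congr_ae (coeFn_truncSignal T u)]
  exact eLpNorm_indicator_le _

/-- Truncation as a linear map of `L₂ₑ`. -/
def truncLinear (T : ℝ) : L2e n →ₗ[ℝ] L2e n where
  toFun := trunc T
  map_add' u v := Subtype.ext (truncSignal_add T (u : Signal n) (v : Signal n))
  map_smul' c u := Subtype.ext (truncSignal_smul T c (u : Signal n))

theorem trunc_add (T : ℝ) (u v : L2e n) : trunc T (u + v) = trunc T u + trunc T v :=
  (truncLinear T).map_add u v

theorem trunc_sub (T : ℝ) (u v : L2e n) : trunc T (u - v) = trunc T u - trunc T v :=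
  map_sub (truncLinear T) u v

theorem trunc_zero_right (T : ℝ) : trunc T (0 : L2e n) = 0 :=
  (truncLinear T).map_zero

theorem trunc_trunc (T : ℝ) (u : L2e n) : trunc T (trunc T u) = trunc T u :=
  Subtype.ext (truncSignal_truncSignal_of_le le_rfl _)

theorem trunc_eq_of_le {S T : ℝ} (h : S ≤ T) {u v : L2e n} (huv : trunc T u = trunc T v) :
    trunc S u = trunc S v := by
  apply Subtype.ext
  have := congrArg Subtype.val huv
  change truncSignal S _ = truncSignal S _
  rw [← truncSignal_truncSignal_of_le h, ← truncSignal_truncSignal_of_le h (v : Signal n)]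
  exact congrArg _ this

theorem trunc_zero_left (u : L2e n) : trunc 0 u = 0 := by
  rw [← trunc_zero_right 0]
  apply Subtype.ext
  refine truncSignal_eq_iff.2 ?_
  have : ∀ᵐ t ∂timeMeasure, t ≠ 0 := by
    have h0 : timeMeasure {(0 : ℝ)} = 0 := by
      refine le_antisymm ((Measure.restrict_apply_le _ _).trans ?_) bot_le
      simp
    exact compl_mem_ae_iff.2 h0
  filter_upwards [this] with t ht ht'
  exact absurd (le_antisymm ht'.2 ht'.1) ht

theorem eq_of_forall_trunc_eq {u v : L2e n} (h : ∀ T : ℝ, 0 < T → trunc T u = trunc T v) :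
    u = v := by
  apply Subtype.ext
  apply AEEqFun.ext
  have h1 : ∀ᵐ t ∂timeMeasure, ∀ k : ℕ, t ∈ Icc 0 ((k : ℝ) + 1) →
      (u : Signal n) t = (v : Signal n) t :=
    ae_all_iff.2 fun k =>
      truncSignal_eq_iff.1 (congrArg Subtype.val (h ((k : ℝ) + 1) (by positivity)))
  filter_upwards [h1, ae_restrict_mem measurableSet_Ici] with t ht (ht0 : 0 ≤ t)
  obtain ⟨k, hk⟩ := exists_nat_ge t
  exact ht k ⟨ht0, hk.trans (by linarith)⟩

/-- Signals that agree on `[0, k + 1]` from the `k`-th on have a common extension. -/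
theorem exists_glue (x : ℕ → Signal n)
    (hx : ∀ k l : ℕ, k ≤ l → truncSignal ((k : ℝ) + 1) (x l) = truncSignal ((k : ℝ) + 1) (x k)) :
    ∃ w : Signal n, ∀ k : ℕ, truncSignal ((k : ℝ) + 1) w = truncSignal ((k : ℝ) + 1) (x k) := by
  -- At time `t` the signal of index `⌊t⌋₊` is already final, because `t ≤ ⌊t⌋₊ + 1`.
  have hmeas : Measurable fun t : ℝ => x ⌊t⌋₊ t :=
    (measurable_from_prod_countable_right (f := fun p : ℕ × ℝ => x p.1 p.2)
      fun k => (x k).measurable).comp (Nat.measurable_floor.prodMk measurable_id)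
  refine ⟨AEEqFun.mk _ hmeas.aestronglyMeasurable, fun k => truncSignal_eq_iff.2 ?_⟩
  have h1 : ∀ᵐ t ∂timeMeasure, ∀ k l : ℕ, k ≤ l → t ∈ Icc 0 ((k : ℝ) + 1) → x l t = x k t :=
    ae_all_iff.2 fun k => ae_all_iff.2 fun l => by
      by_cases hkl : k ≤ l
      · filter_upwards [truncSignal_eq_iff.1 (hx k l hkl)] with t ht _ using ht
      · exact Eventually.of_forall fun t h => absurd h hkl
  filter_upwards [h1, AEEqFun.coeFn_mk (μ := timeMeasure) _ hmeas.aestronglyMeasurable]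
    with t ht h2 htk
  rw [h2]
  rcases le_total ⌊t⌋₊ k with h | h
  · exact (ht _ _ h ⟨htk.1, (Nat.lt_floor_add_one t).le⟩).symm
  · exact ht _ _ h htk

end Truncation

/-! ### Causal operators on `L₂`: inversion, and extension to `L₂ₑ`. -/

section SquareIntegrable

variable {n : ℕ}

/-- The Hilbert space of square-integrable signals. -/
abbrev L2Space (n : ℕ) : Type := Lp (EuclideanSpace ℝ (Fin n)) 2 timeMeasure

/-- The inclusion `L₂ ⊆ L₂ₑ`. -/
def L2Space.toL2e : L2Space n →ₗ[ℝ] L2e n where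
  toFun u := ⟨u, fun T _ => InL2.truncSignal (Lp.memLp u) T⟩
  map_add' _ _ := rfl
  map_smul' _ _ := rfl

/-- Truncation as a map from `L₂ₑ` to `L₂`. -/
def truncToL2 (T : ℝ) (hT : 0 < T) (u : L2e n) : L2Space n :=
  ⟨truncSignal T u, Lp.mem_Lp_iff_memLp.2 (u.2 T hT)⟩

theorem toL2e_truncToL2 (T : ℝ) (hT : 0 < T) (u : L2e n) :
    (truncToL2 T hT u).toL2e = trunc T u := rfl

theorem L2Space.toL2e_inL2 (u : L2Space n) : InL2 (u.toL2e : Signal n) := Lp.memLp u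

theorem L2Space.toL2e_sub (u v : L2Space n) : (u - v).toL2e = u.toL2e - v.toL2e :=
  map_sub L2Space.toL2e u v

/-- The square-integrable signals that vanish on `[0, T]`. -/
def vanishingUntil (n : ℕ) (T : ℝ) : Submodule ℝ (L2Space n) :=
  LinearMap.ker (truncLinear T ∘ₗ L2Space.toL2e)

theorem mem_vanishingUntil {T : ℝ} {u : L2Space n} :
    u ∈ vanishingUntil n T ↔ trunc T u.toL2e = 0 := Iff.rfl

theorem isClosed_vanishingUntil (T : ℝ) : IsClosed (vanishingUntil n T : Set (L2Space n)) := by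
  let L : L2Space n →ₗ[ℝ] L2Space n :=
    { toFun := fun u => ⟨truncSignal T u, Lp.mem_Lp_iff_memLp.2 (InL2.truncSignal (Lp.memLp u) T)⟩
      map_add' := fun u v => Subtype.ext (truncSignal_add T (u : Signal n) (v : Signal n))
      map_smul' := fun c u => Subtype.ext (truncSignal_smul T c (u : Signal n)) }
  let L' : L2Space n →L[ℝ] L2Space n := L.mkContinuous 1 fun u => by
    rw [one_mul, Lp.norm_def, Lp.norm_def]
    exact ENNReal.toReal_mono (Lp.eLpNorm_ne_top u) (l2norm_truncSignal_le T _)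
  have : (vanishingUntil n T : Set (L2Space n)) = L' ⁻¹' {0} := by
    ext u
    rw [SetLike.mem_coe, mem_vanishingUntil, mem_preimage, mem_singleton_iff, Subtype.ext_iff,
      Subtype.ext_iff]
    rfl
  rw [this]
  exact isClosed_singleton.preimage L'.continuous

/-- Causality of operators on `L₂`. -/
def CausalOperator (A : L2Space n →L[ℝ] L2Space n) : Prop :=
  ∀ T : ℝ, 0 < T → ∀ u ∈ vanishingUntil n T, A u ∈ vanishingUntil n T

theorem CausalOperator.trunc_eq {A : L2Space n →L[ℝ] L2Space n} (hA : CausalOperator A) {T : ℝ}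
    (hT : 0 < T) {u v : L2Space n} (h : trunc T u.toL2e = trunc T v.toL2e) :
    trunc T (A u).toL2e = trunc T (A v).toL2e := by
  have h0 : trunc T (u - v).toL2e = 0 := by
    rw [map_sub, trunc_sub, h]
    exact sub_self (trunc T v.toL2e)
  have h1 : trunc T (A (u - v)).toL2e = 0 := hA T hT (u - v) h0
  rw [map_sub, map_sub, trunc_sub] at h1
  exact sub_eq_zero.1 h1

/-- A system with an `RH_∞` transfer matrix restricts to a causal bounded operator on `L₂`. -/
theorem IsLTIWithTransferMatrix.exists_operator {P : System n} {Phat : TransferMatrix n}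
    (hP : IsLTIWithTransferMatrix P Phat) (hR : IsRHInfty Phat) :
    ∃ A : L2Space n →L[ℝ] L2Space n, CausalOperator A ∧ ∀ u, (A u).toL2e = P u.toL2e := by
  obtain ⟨K, hK0, hK⟩ := hP.exists_gain hR
  let L : L2Space n →ₗ[ℝ] L2Space n :=
    { toFun := fun u => ⟨P u.toL2e, Lp.mem_Lp_iff_memLp.2 (hP.inL2 hR u.toL2e_inL2)⟩
      map_add' := fun u v => Subtype.ext
        (congrArg (fun z : L2e n => (z : Signal n)) (hP.map_add u.toL2e v.toL2e))
      map_smul' := fun c u => Subtype.ext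
        (congrArg (fun z : L2e n => (z : Signal n)) (hP.map_smul c u.toL2e)) }
  refine ⟨L.mkContinuous K fun u => ?_, fun T hT u hu => ?_, fun u => rfl⟩
  · rw [Lp.norm_def, Lp.norm_def, ← ENNReal.toReal_ofReal hK0, ← ENNReal.toReal_mul]
    exact ENNReal.toReal_mono (ENNReal.mul_ne_top ENNReal.ofReal_ne_top (Lp.eLpNorm_ne_top u))
      (hK u.toL2e u.toL2e_inL2)
  · have h0 : P 0 = 0 := by simpa using hP.map_smul 0 0
    rw [mem_vanishingUntil] at hu ⊢
    have := hP.causal T hT u.toL2e 0 (by rw [hu, trunc_zero_right])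
    rw [h0, trunc_zero_right] at this
    exact this

/-- If `1 - τ a` is bounded below on `L₂` uniformly in `τ ∈ [0, 1]` and `a` is causal, then
`1 - a` has a causal inverse. -/
theorem CausalOperator.exists_inverse {A : L2Space n →L[ℝ] L2Space n} (hA : CausalOperator A)
    {K : ℝ} (hK : 0 < K)
    (h : ∀ τ ∈ Icc (0 : ℝ) 1, ∀ u : L2Space n, ‖u‖ ≤ K * ‖u - τ • A u‖) :
    ∃ R : L2Space n →L[ℝ] L2Space n, CausalOperator R ∧ (∀ u, R (u - A u) = u) ∧
      ∀ u, R u - A (R u) = u := by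
  -- Continuation takes place among causal operators, so the inverse it yields is causal without
  -- further argument.
  set 𝒜 := invariantSubalgebra fun T : {T : ℝ // 0 < T} => vanishingUntil n (T : ℝ)
  have hclosed : IsClosed (𝒜 : Set (L2Space n →L[ℝ] L2Space n)) :=
    isClosed_invariantSubalgebra _ fun T => isClosed_vanishingUntil _
  have : CompleteSpace 𝒜 := hclosed.completeSpace_coe
  let a : 𝒜 := ⟨A, fun T u hu => hA T T.2 u hu⟩
  -- The lower bound applied to `u = b y`, where `u - τ A u = y`, says exactly that a right inverse
  -- `b` has norm at most `K`.
  obtain ⟨x, hx⟩ := isUnit_one_sub_of_inverse_bound a hK fun τ hτ b hb => by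
    refine ContinuousLinearMap.opNorm_le_bound _ hK.le fun y => ?_
    refine (h τ hτ _).trans_eq ?_
    have h1 := congrArg (fun c : 𝒜 => (c : L2Space n →L[ℝ] L2Space n) y) hb
    have h2 : (b : L2Space n →L[ℝ] L2Space n) y - τ • A ((b : L2Space n →L[ℝ] L2Space n) y) = y :=
      h1
    exact congrArg (fun z => K * ‖z‖) h2
  refine ⟨((x⁻¹ : 𝒜ˣ) : 𝒜), fun T hT u hu => ((x⁻¹ : 𝒜ˣ) : 𝒜).2 ⟨T, hT⟩ u hu, fun u => ?_,
    fun u => ?_⟩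
  · have h1 := x.inv_mul
    rw [hx] at h1
    exact congrArg (fun c : 𝒜 => (c : L2Space n →L[ℝ] L2Space n) u) h1
  · have h1 := x.mul_inv
    rw [hx] at h1
    exact congrArg (fun c : 𝒜 => (c : L2Space n →L[ℝ] L2Space n) u) h1

/-- A causal operator on `L₂` extends to `L₂ₑ`. -/
theorem CausalOperator.exists_extension {R : L2Space n →L[ℝ] L2Space n} (hR : CausalOperator R) :
    ∃ S : System n, ∀ (T : ℝ) (hT : 0 < T) (d : L2e n),
      trunc T (S d) = trunc T (R (truncToL2 T hT d)).toL2e := by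
  have key (d : L2e n) : ∃ w : L2e n, ∀ (T : ℝ) (hT : 0 < T),
      trunc T w = trunc T (R (truncToL2 T hT d)).toL2e := by
    -- By causality, the responses to longer truncations of `d` agree on `[0, S]`, so they can be
    -- glued.
    have hcons {S T : ℝ} (hS : 0 < S) (hT : 0 < T) (hST : S ≤ T) :
        trunc S (R (truncToL2 T hT d)).toL2e = trunc S (R (truncToL2 S hS d)).toL2e := by
      refine hR.trunc_eq hS ?_
      rw [toL2e_truncToL2, toL2e_truncToL2, trunc_trunc]
      exact trunc_eq_of_le hST (trunc_trunc T d)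
    have hk (k : ℕ) : (0 : ℝ) < (k : ℝ) + 1 := by positivity
    obtain ⟨w, hw⟩ := exists_glue
      (fun k => ((R (truncToL2 ((k : ℝ) + 1) (hk k) d)).toL2e : Signal n))
      fun k l hkl => congrArg Subtype.val (hcons (hk k) (hk l) (by gcongr))
    have htr (T : ℝ) (hT : 0 < T) :
        truncSignal T w = truncSignal T (R (truncToL2 T hT d)).toL2e := by
      obtain ⟨k, hTk⟩ := exists_nat_ge T
      have hTk' : T ≤ (k : ℝ) + 1 := by linarith
      rw [← truncSignal_truncSignal_of_le hTk', hw k, truncSignal_truncSignal_of_le hTk']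
      exact congrArg Subtype.val (hcons hT (hk k) hTk')
    refine ⟨⟨w, fun T hT => ?_⟩, fun T hT => Subtype.ext (htr T hT)⟩
    rw [htr T hT]
    exact InL2.truncSignal (L2Space.toL2e_inL2 _) T
  choose S hS using key
  exact ⟨S, fun T hT d => hS d T hT⟩

end SquareIntegrable

/-! ### The inverse of the feedback operator and its gain. -/

section ClosedLoop

variable {n : ℕ}

/-- Gain of a system with respect to truncated norms. -/
def HasGain (S : System n) (k : ℝ) : Prop :=
  ∀ T : ℝ, 0 < T → ∀ u : L2e n,
    l2norm (trunc T (S u) : Signal n) ≤ ENNReal.ofReal k * l2norm (trunc T u : Signal n)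

/-- Causality replaces the input by its truncation, which lies in `L₂`, where the gain bound is
available. -/
theorem IsLTIWithTransferMatrix.exists_hasGain {P : System n} {Phat : TransferMatrix n}
    (hP : IsLTIWithTransferMatrix P Phat) (hR : IsRHInfty Phat) : ∃ k, 0 ≤ k ∧ HasGain P k := by
  obtain ⟨K, hK0, hK⟩ := hP.exists_gain hR
  refine ⟨K, hK0, fun T hT u => ?_⟩
  rw [hP.causal T hT u (trunc T u) (trunc_trunc T u).symm]
  exact (l2norm_truncSignal_le T _).trans (hK (trunc T u) (u.2 T hT))

theorem l2norm_toL2e_le (R : L2Space n →L[ℝ] L2Space n) (u : L2Space n) :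
    l2norm ((R u).toL2e : Signal n) ≤ ENNReal.ofReal ‖R‖ * l2norm (u.toL2e : Signal n) := by
  have h := R.le_opENorm u
  rw [Lp.enorm_def, Lp.enorm_def, ← ofReal_norm] at h
  exact h

theorem l2norm_fst_le (d : L2e n × L2e n) : l2norm (d.1 : Signal n) ≤ l2normPair d := by
  rw [l2normPair, one_div, ENNReal.le_rpow_inv_iff two_pos]
  exact_mod_cast le_self_add

theorem l2norm_snd_le (d : L2e n × L2e n) : l2norm (d.2 : Signal n) ≤ l2normPair d := by
  rw [l2normPair, one_div, ENNReal.le_rpow_inv_iff two_pos]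
  exact_mod_cast le_add_self

theorem l2normPair_le_add (d : L2e n × L2e n) :
    l2normPair d ≤ l2norm (d.1 : Signal n) + l2norm (d.2 : Signal n) := by
  rw [l2normPair, one_div, ENNReal.rpow_inv_le_iff two_pos]
  norm_cast
  rw [add_sq]
  exact add_le_add_left le_self_add _

theorem l2norm_add_le (u v : Signal n) : l2norm (u + v) ≤ l2norm u + l2norm v := by
  rw [l2norm, eLpNorm_congr_ae (AEEqFun.coeFn_add u v)]
  exact eLpNorm_add_le u.aestronglyMeasurable v.aestronglyMeasurable (by norm_num)

/-- A causal inverse of `1 - C P` gives a causal finite-gain inverse of the feedback operator. -/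
theorem closedLoopStable_of_inverse {P C S : System n} {p c r : ℝ}
    (hP : Causal P) (hC : Causal C) (hS : Causal S) (hCadd : ∀ u v, C (u + v) = C u + C v)
    (hp0 : 0 ≤ p) (hc0 : 0 ≤ c) (hr0 : 0 ≤ r)
    (hPg : HasGain P p) (hCg : HasGain C c) (hSg : HasGain S r)
    (hleft : ∀ u, S (u - C (P u)) = u) (hright : ∀ e, S e - C (P (S e)) = e) :
    ClosedLoopStable P C := by
  have hCsub (u v : L2e n) : C (u - v) = C u - C v := by
    have h := hCadd (u - v) v
    have h1 : u - v + v = u := sub_add_cancel u v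
    rw [h1] at h
    exact (sub_eq_of_eq_add (a := C u) (b := C v) h).symm
  -- Eliminating `y₂ = d₂ + P u₁` from `u₁ = d₁ + C y₂` gives `(1 - C P) u₁ = d₁ + C d₂`, thanks to
  -- the additivity of `C`.
  set H : L2e n × L2e n → L2e n × L2e n := fun d =>
    (S (d.1 + C d.2), d.2 + P (S (d.1 + C d.2))) with hH
  have hinv : IsCausalInverse P C H := by
    refine ⟨fun x => ?_, fun d => ?_, fun T hT d e hde => ?_⟩
    · have h1 : x.1 - C x.2 + C (x.2 - P x.1) = x.1 - C (P x.1) := by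
        rw [hCsub]
        exact sub_add_sub_cancel x.1 (C x.2) (C (P x.1))
      have h2 : S ((feedbackMap P C x).1 + C (feedbackMap P C x).2) = x.1 := by
        rw [feedbackMap, h1, hleft]
      refine Prod.ext h2 ?_
      simp only [hH, h2]
      exact sub_add_cancel x.2 (P x.1)
    · refine Prod.ext ?_ (add_sub_cancel_right d.2 (P (S (d.1 + C d.2))))
      have h1 := hright (d.1 + C d.2)
      simp only [hH, feedbackMap]
      calc S (d.1 + C d.2) - C (d.2 + P (S (d.1 + C d.2)))
          = S (d.1 + C d.2) - (C d.2 + C (P (S (d.1 + C d.2)))) := by rw [hCadd d.2]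
        _ = S (d.1 + C d.2) - C (P (S (d.1 + C d.2))) - C d.2 :=
            sub_add_eq_sub_sub_swap (S (d.1 + C d.2)) (C d.2) (C (P (S (d.1 + C d.2))))
        _ = d.1 + C d.2 - C d.2 := by rw [h1]
        _ = d.1 := add_sub_cancel_right d.1 (C d.2)
    · have hd1 : trunc T d.1 = trunc T e.1 := congrArg Prod.fst hde
      have hd2 : trunc T d.2 = trunc T e.2 := congrArg Prod.snd hde
      have h1 : trunc T (S (d.1 + C d.2)) = trunc T (S (e.1 + C e.2)) := by
        refine hS T hT _ _ ?_
        rw [trunc_add, trunc_add, hd1, hC T hT _ _ hd2]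
      refine Prod.ext h1 ?_
      simp only [hH, Prod.map_snd]
      rw [trunc_add, trunc_add, hd2, hP T hT _ _ h1]
  refine ⟨⟨H, hinv⟩, fun H' hH' => ?_⟩
  have hHH' : H' = H := by
    funext d
    have := hH'.left_inv (H d)
    rwa [hinv.right_inv d] at this
  rw [hHH']
  -- `k₁` bounds the gain to `u₁ = S (d₁ + C d₂)`, and `k₂` the gain to `y₂ = d₂ + P u₁`.
  set k₁ := r * (1 + c) with hk₁
  set k₂ := 1 + p * k₁ with hk₂
  have hk₁0 : 0 ≤ k₁ := by positivity
  have hk₂0 : 0 < k₂ := by positivity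
  refine ⟨k₁ + k₂, by positivity, fun T hT0 d => ?_⟩
  -- Gains are available only for `T > 0`; at `T = 0` every truncation vanishes, as `{0}` is a null
  -- set.
  rcases hT0.eq_or_lt with rfl | hT
  · have h0 : Prod.map (trunc 0) (trunc 0) (H d) = Prod.map (trunc 0) (trunc 0) (0, 0) :=
      Prod.ext ((trunc_zero_left _).trans (trunc_zero_left _).symm)
        ((trunc_zero_left _).trans (trunc_zero_left _).symm)
    have hz : l2norm ((0 : L2e n) : Signal n) = 0 := by
      rw [l2norm]
      exact (eLpNorm_congr_ae AEEqFun.coeFn_zero).trans eLpNorm_zero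
    rw [h0]
    refine le_trans ?_ bot_le
    refine (l2normPair_le_add _).trans ?_
    simp only [Prod.map_fst, Prod.map_snd]
    rw [trunc_zero_left, hz, add_zero]
    rfl
  set N := l2normPair (Prod.map (trunc T) (trunc T) d) with hN
  have ha : l2norm (trunc T d.1 : Signal n) ≤ N := l2norm_fst_le (Prod.map (trunc T) (trunc T) d)
  have hb : l2norm (trunc T d.2 : Signal n) ≤ N := l2norm_snd_le (Prod.map (trunc T) (trunc T) d)
  have he : l2norm (trunc T (d.1 + C d.2) : Signal n) ≤ ENNReal.ofReal (1 + c) * N := by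
    rw [trunc_add, ENNReal.ofReal_add zero_le_one hc0, ENNReal.ofReal_one, add_mul, one_mul]
    exact (l2norm_add_le _ _).trans (add_le_add ha ((hCg T hT _).trans (by gcongr)))
  have hu : l2norm (trunc T (S (d.1 + C d.2)) : Signal n) ≤ ENNReal.ofReal k₁ * N := by
    rw [hk₁, ENNReal.ofReal_mul hr0, mul_assoc]
    exact (hSg T hT _).trans (by gcongr)
  have hy : l2norm (trunc T (d.2 + P (S (d.1 + C d.2))) : Signal n) ≤
      ENNReal.ofReal k₂ * N := by
    rw [trunc_add, hk₂, ENNReal.ofReal_add zero_le_one (by positivity), ENNReal.ofReal_one,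
      add_mul, one_mul, ENNReal.ofReal_mul hp0, mul_assoc]
    exact (l2norm_add_le _ _).trans (add_le_add hb ((hPg T hT _).trans (by gcongr)))
  refine (l2normPair_le_add _).trans ?_
  rw [ENNReal.ofReal_add hk₁0 hk₂0.le, add_mul]
  exact add_le_add hu hy

/-- A causal two-sided inverse of `1 - C P` on `L₂` extends to `L₂ₑ`. -/
theorem exists_system_inverse {Q : System n} (hQ : Causal Q)
    {A R : L2Space n →L[ℝ] L2Space n} (hA : ∀ u, (A u).toL2e = Q u.toL2e)
    (hR : CausalOperator R) (hleft : ∀ u, R (u - A u) = u) (hright : ∀ u, R u - A (R u) = u) :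
    ∃ S : System n, Causal S ∧ HasGain S ‖R‖ ∧ (∀ u, S (u - Q u) = u) ∧ ∀ e, S e - Q (S e) = e := by
  obtain ⟨S, hS⟩ := hR.exists_extension
  refine ⟨S, fun T hT u v huv => ?_, fun T hT u => ?_, fun u => ?_, fun e => ?_⟩
  · rw [hS T hT, hS T hT]
    refine hR.trunc_eq hT ?_
    rw [toL2e_truncToL2, toL2e_truncToL2, huv]
  · rw [hS T hT]
    exact (l2norm_truncSignal_le T _).trans (l2norm_toL2e_le R (truncToL2 T hT u))
  · refine eq_of_forall_trunc_eq fun T hT => ?_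
    set v := truncToL2 T hT u with hv
    have hvu : trunc T v.toL2e = trunc T u := by rw [hv, toL2e_truncToL2, trunc_trunc]
    -- Up to time `T`, the signal `u - Q u` is indistinguishable from `v - A v`, with `v ∈ L₂` the
    -- truncation of `u`; there the inverse `R` applies.
    have h1 : trunc T (truncToL2 T hT (u - Q u)).toL2e = trunc T (v - A v).toL2e := by
      rw [toL2e_truncToL2, trunc_trunc, map_sub, trunc_sub, trunc_sub, hvu, hA, hQ T hT _ _ hvu]
    rw [hS T hT, hR.trunc_eq hT h1, hleft, hvu]
  · refine eq_of_forall_trunc_eq fun T hT => ?_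
    have h2 := hQ T hT (S e) (R (truncToL2 T hT e)).toL2e (hS T hT e)
    rw [trunc_sub, hS T hT, h2, ← hA, ← trunc_sub, ← L2Space.toL2e_sub, hright, toL2e_truncToL2, trunc_trunc]

end ClosedLoop

end FeedbackNI

end

/-! ### Assembly of the corollary. -/

open FeedbackNI in
theorem corollary2 (n : ℕ) (P C : System n) (Phat Chat : TransferMatrix n)
    (hP : IsLTIWithTransferMatrix P Phat) (hC : IsLTIWithTransferMatrix C Chat)
    (hSNI : IsSNI Phat) (hNI : IsNI Chat)
    (hquad : ∃ Ξ₀ Ξinf : Matrix (Fin n ⊕ Fin n) (Fin n ⊕ Fin n) ℂ,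
      Ξ₀.IsHermitian ∧ Ξinf.IsHermitian ∧
      ∀ τ : ℝ, τ ∈ Set.Icc (0 : ℝ) 1 →
        (-(quadForm Ξ₀ (TransferMatrix.at Phat 0) 1)).PosDef ∧
        (quadForm Ξ₀ 1 ((τ : ℂ) • TransferMatrix.at Chat 0)).PosSemidef ∧
        (-(quadForm Ξinf (TransferMatrix.atInfty Phat) 1)).PosDef ∧
        (quadForm Ξinf 1 ((τ : ℂ) • TransferMatrix.atInfty Chat)).PosSemidef) :
    ClosedLoopStable P C := by
  obtain ⟨Ξ₀, Ξinf, -, -, hΞ⟩ := hquad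
  -- The inequalities on `Phat` do not involve `τ`, so they are read off at `τ = 0`.
  have h01 : (0 : ℝ) ∈ Set.Icc (0 : ℝ) 1 := ⟨le_rfl, zero_le_one⟩
  have hzero := loopNonsingular_of_quadForm (TransferMatrix.conjTranspose_at_zero Phat)
    (TransferMatrix.conjTranspose_at_zero Chat) (hΞ 0 h01).1 fun τ hτ => (hΞ τ hτ).2.1
  have hinf := loopNonsingular_of_quadForm hSNI.stable.conjTranspose_atInfty
    hNI.stable.conjTranspose_atInfty (hΞ 0 h01).2.2.1 fun τ hτ => (hΞ τ hτ).2.2.2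
  have haxis := loopNonsingular_imaginary_axis hSNI hNI hzero
  obtain ⟨K, hK, hbound⟩ :=
    exists_return_difference_bound hP hC hSNI.stable hNI.stable haxis hinf
  obtain ⟨A, hAc, hA⟩ := hP.exists_operator hSNI.stable
  obtain ⟨B, hBc, hB⟩ := hC.exists_operator hNI.stable
  have hBA (u : L2Space n) : ((B * A) u).toL2e = C (P u.toL2e) := (hB (A u)).trans (by rw [hA])
  have hBAc : CausalOperator (B * A) := fun T hT u hu => hBc T hT _ (hAc T hT u hu)
  obtain ⟨R, hRc, hleft, hright⟩ := hBAc.exists_inverse hK fun τ hτ u => by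
    have h := hbound τ hτ u.toL2e u.toL2e_inL2
    rw [← hBA, ← map_smul, ← L2Space.toL2e_sub] at h
    rw [MeasureTheory.Lp.norm_def, MeasureTheory.Lp.norm_def, ← ENNReal.toReal_ofReal hK.le,
      ← ENNReal.toReal_mul]
    exact ENNReal.toReal_mono (ENNReal.mul_ne_top ENNReal.ofReal_ne_top
      (MeasureTheory.Lp.eLpNorm_ne_top _)) h
  have hQ : Causal fun u => C (P u) := fun T hT u v huv =>
    hC.causal T hT _ _ (hP.causal T hT u v huv)
  obtain ⟨S, hSc, hSg, hSleft, hSright⟩ := exists_system_inverse hQ hBA hRc hleft hright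
  obtain ⟨p, hp0, hp⟩ := hP.exists_hasGain hSNI.stable
  obtain ⟨c, hc0, hc⟩ := hC.exists_hasGain hNI.stable
  exact closedLoopStable_of_inverse hP.causal hC.causal hSc hC.map_add hp0 hc0 (norm_nonneg R)
    hp hc hSg hSleft hSright
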